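/- All manifolds are smooth, Hausdorff, finite-dimensional and without boundary. For a manifold $M$ let $\mathbb{T}M = TM\oplus T^*M$, with the pairing $\langle (X,\alpha),(Y,\beta)\rangle = \beta(X)+\alpha(Y)$ and the Courant–Dorfman bracket $[\![(X,\alpha),(Y,\beta)]\!] = ([X,Y],\mathcal{L}_X\beta - i_Y d\alpha)$. A *Dirac structure* is a smooth subbundle $L\subset\mathbb{T}M$ with $L=L^\perp$ whose space of sections is closed under this bracket. For a smooth $(1,1)$-tensor field $r\in\Omega^1(M,TM)$ and $X,Y\in\mathfrak{X}(M)$, $\alpha\in\Omega^1(M)$ put $$D^r_X(Y) = [Y,r(X)]-r([Y,X]),\qquad D^{r,*}_X(\alpha)=\mathcal{L}_X(r^*\alpha)-\mathcal{L}_{r(X)}\alpha .$$ The pair $(L,r)$ is *compatible* if $(r,r^*)(L)\subseteq L$ and $(D^r_X,D^{r,*}_X)(\Gamma(L))\subseteq\Gamma(L)$ for all $X\in\mathfrak{X}(M)$. The tensor $r$ is *Nijenhuis* if $[rX,rY]-r([rX,Y]+[X,rY]-r[X,Y])=0$ for all $X,Y \in \mathfrak{X}(M)$, and $(L,r)$ is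 *Dirac–Nijenhuis* if it is compatible, $L$ is Dirac and $r$ is Nijenhuis. A $2$-form $\omega$, with $\omega^\flat(X)=i_X\omega$, and a tensor $r$ are *compatible* if $\omega^\flat\circ r=r^*\circ\omega^\flat$ and $D^{r,*}_X(\omega^\flat(Y))=\omega^\flat(D^r_X(Y))$ for all $X,Y\in\mathfrak{X}(M)$; such a pair is *presymplectic–Nijenhuis* if moreover $\omega$ is closed and $r$ is Nijenhuis. For a smooth map $\psi:N\to M$ and a Dirac structure $L_M$ on $M$ put $$\mathcal{B}_\psi(L_M)_x=\{(X,(T_x\psi)^*\beta)\in\mathbb{T}_xN : (T_x\psi(X),\beta)\in (L_M)_{\psi(x)}\},\qquad x\in N .$$ If $L_N$ is a Dirac structure on $N$, then $\psi:(N,L_N)\to(M,L_M)$ is a *backward Dirac map* if $L_N=\mathcal{B}_\psi(L_M)$. Tensors $r_N\in\Omega^1(N,TN)$ and $r_M\in\Omega^1(M,TM)$ are *$\psi$-related* if $r_M\circ d\psi=d\psi\circ r_N$. **Proposition 4.1 and its corollaries.** Let $\psi:N\to M$ be a smooth map, $L_M$ a Dirac structure on $M$, and $r_M\in\Omega^1(M,TM)$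 compatible with $L_M$. 1. If $L_N$ is a Dirac structure on $N$ such that $\psi:(N,L_N)\to(M,L_M)$ is a backward Dirac map, and $r_N\in\Omega^1(N,TN)$ is $\psi$-related to $r_M$, then $L_N$ is compatible with $r_N$. 2. Suppose that $\psi$ is an injective immersion (so $N$ is a submanifold of $M$), that $N$ is $r_M$-invariant, i.e. $r_M(d\psi(TN))\subseteq d\psi(TN)$, and that $\mathcal{B}_\psi(L_M)$ is a smooth subbundle of $\mathbb{T}N$. Then there is a smooth $(1,1)$-tensor field $r_N$ on $N$ that is $\psi$-related to $r_M$ (the restriction of $r_M$), $\mathcal{B}_\psi(L_M)$ is a Dirac structure, and it is compatible with $r_N$. If $r_M$ is Nijenhuis, then $(\mathcal{B}_\psi(L_M),r_N)$ is a Dirac–Nijenhuis structure. 3. Suppose that $\psi$ is an injective immersion and that $T_x\psi(T_xN)=\mathrm{pr}_{TM}((L_M)_{\psi(x)})$ for all $x\in N$; for example, that $N$ is a presymplectic leaf of $L_M$ (a maximal connected submanifold with this property). Then $N$ is $r_M$-invariant, and there are a smooth $(1,1)$-tensor field $r_N$ on $N$ that is $\psi$-related to $r_M$ and a closed $2$-form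 $\omega$ on $N$ whose graph $\{(X,\omega^\flat(X))\}$ is $\mathcal{B}_\psi(L_M)$ (the presymplectic form), such that $\omega$ is compatible with $r_N$. If $r_M$ is Nijenhuis, then $(\omega,r_N)$ is a presymplectic–Nijenhuis structure. -/

import Mathlib

open scoped Manifold ContDiff

/-!
Generalized tangent bundles, Dirac structures, `(1,1)`-tensor fields and their compatibility, on
smooth manifolds without boundary modelled on a finite-dimensional real vector space `E`
(that is, charted on `E` with the model with corners `𝓘(ℝ, E)`).
-/

noncomputable section

namespace DiracGeom

/-! ### Tensor fields -/

section Basic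

variable {E : Type*} [NormedAddCommGroup E] [NormedSpace ℝ E]
  {M : Type*} [TopologicalSpace M] [ChartedSpace E M]

variable (E) in
/-- The tangent space `T_x M`. -/
abbrev Tan (x : M) : Type _ := TangentSpace 𝓘(ℝ, E) x

variable (E) in
/-- The cotangent space `T*_x M`. -/
abbrev Cot (x : M) : Type _ := Tan E x →L[ℝ] Bundle.Trivial M ℝ x

variable (E M) in
/-- Not necessarily smooth vector fields. -/
abbrev VField : Type _ := ∀ x : M, Tan E x

variable (E M) in
/-- Not necessarily smooth `1`-forms. -/
abbrev OneForm : Type _ := ∀ x : M, Cot E x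

variable (E M) in
/-- Not necessarily smooth `(1,1)`-tensor fields, i.e. fields of endomorphisms of `TM`. -/
abbrev Tensor11 : Type _ := ∀ x : M, Tan E x →L[ℝ] Tan E x

variable (E M) in
/-- Not necessarily smooth fields of bilinear forms on `TM`. -/
abbrev BilinField : Type _ := ∀ x : M, Tan E x →L[ℝ] Cot E x

/-- The vector field `X` is smooth on `U`. -/
def SmoothVFieldOn [IsManifold 𝓘(ℝ, E) ∞ M] (X : VField E M) (U : Set M) : Prop :=
  ContMDiffOn 𝓘(ℝ, E) (𝓘(ℝ, E).prod 𝓘(ℝ, E)) ∞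
    (fun x => Bundle.TotalSpace.mk' E (E := fun x : M => Tan E x) x (X x)) U

/-- The `1`-form `α` is smooth on `U`. -/
def SmoothOneFormOn [IsManifold 𝓘(ℝ, E) ∞ M] (α : OneForm E M) (U : Set M) : Prop :=
  ContMDiffOn 𝓘(ℝ, E) (𝓘(ℝ, E).prod 𝓘(ℝ, E →L[ℝ] ℝ)) ∞
    (fun x => Bundle.TotalSpace.mk' (E →L[ℝ] ℝ) (E := fun x : M => Cot E x) x (α x)) U

/-- `X ∈ 𝔛(M)`. -/
def SmoothVField [IsManifold 𝓘(ℝ, E) ∞ M] (X : VField E M) : Prop := SmoothVFieldOn X Set.univ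

/-- `α ∈ Ω¹(M)`. -/
def SmoothOneForm [IsManifold 𝓘(ℝ, E) ∞ M] (α : OneForm E M) : Prop :=
  SmoothOneFormOn α Set.univ

/-- `r ∈ Ω¹(M, TM)`, a smooth `(1,1)`-tensor field. -/
def SmoothTensor11 [IsManifold 𝓘(ℝ, E) ∞ M] (r : Tensor11 E M) : Prop :=
  ContMDiff 𝓘(ℝ, E) (𝓘(ℝ, E).prod 𝓘(ℝ, E →L[ℝ] E)) ∞
    (fun x => Bundle.TotalSpace.mk' (E →L[ℝ] E)
      (E := fun x : M => Tan E x →L[ℝ] Tan E x) x (r x))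

/-- `Ω ∈ Ω²(M)`: a smooth field of alternating bilinear forms; `Ω x u = i_u Ω = Ω♭(u)`. -/
structure IsTwoForm [IsManifold 𝓘(ℝ, E) ∞ M] (Ω : BilinField E M) : Prop where
  alternating : ∀ (x : M) (u : Tan E x), Ω x u u = 0
  smooth : ContMDiff 𝓘(ℝ, E) (𝓘(ℝ, E).prod 𝓘(ℝ, E →L[ℝ] E →L[ℝ] ℝ)) ∞
    (fun x => Bundle.TotalSpace.mk' (E →L[ℝ] E →L[ℝ] ℝ)
      (E := fun x : M => Tan E x →L[ℝ] Cot E x) x (Ω x))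

/-! ### Cartan calculus -/

/-- The Lie bracket `[X, Y]`. -/
def bracket (X Y : VField E M) : VField E M := VectorField.mlieBracket 𝓘(ℝ, E) X Y

/-- The vector field `r(X)`. -/
def appV (r : Tensor11 E M) (X : VField E M) : VField E M := fun x => r x (X x)

/-- The `1`-form `r^*(α) = α ∘ r`. -/
def appF (r : Tensor11 E M) (α : OneForm E M) : OneForm E M := fun x => (α x).comp (r x)

/-- The pullback of the `1`-form `α` to the model space `E` along the inverse of the preferred
chart `φ` at `x`; `y ↦ α_{φ⁻¹(y)} ∘ d(φ⁻¹)_y`. -/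
def chartForm (α : OneForm E M) (x : M) : E → (E →L[ℝ] ℝ) := fun y =>
  ContinuousLinearMap.comp (α ((extChartAt 𝓘(ℝ, E) x).symm y))
    (mfderiv 𝓘(ℝ, E) 𝓘(ℝ, E) (extChartAt 𝓘(ℝ, E) x).symm y)

/-- The `1`-form `i_X dα`. In the preferred chart `φ` at `x`, with `a` the coordinate expression of
`α`, one has `dα(u, v) = (D a · dφ(u))(dφ(v)) - (D a · dφ(v))(dφ(u))`. -/
def iExtDeriv (X : VField E M) (α : OneForm E M) : OneForm E M := fun x =>
  let φ := extChartAt 𝓘(ℝ, E) x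
  let A : E →L[ℝ] E →L[ℝ] ℝ := fderiv ℝ (chartForm α x) (φ x)
  let T : Tan E x →L[ℝ] E := mfderiv 𝓘(ℝ, E) 𝓘(ℝ, E) φ x
  (A (T (X x)) - A.flip (T (X x))).comp T

/-- The `1`-form `df` of a function `f`. -/
def dFun (f : M → ℝ) : OneForm E M := fun x => mfderiv 𝓘(ℝ, E) 𝓘(ℝ, ℝ) f x

/-- The Lie derivative `ℒ_X α = i_X dα + d(α(X))` of a `1`-form. -/
def lieDer (X : VField E M) (α : OneForm E M) : OneForm E M :=
  iExtDeriv X α + dFun (fun x => α x (X x))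

/-- `dΩ = 0`, with `dΩ` given by the invariant formula on smooth vector fields. -/
def IsClosedTwoForm [IsManifold 𝓘(ℝ, E) ∞ M] (Ω : BilinField E M) : Prop :=
  ∀ X Y Z : VField E M, SmoothVField X → SmoothVField Y → SmoothVField Z → ∀ x : M,
    dFun (E := E) (fun y => Ω y (Y y) (Z y)) x (X x)
      - dFun (E := E) (fun y => Ω y (X y) (Z y)) x (Y x)
      + dFun (E := E) (fun y => Ω y (X y) (Y y)) x (Z x)
      - Ω x (bracket X Y x) (Z x) + Ω x (bracket X Z x) (Y x) - Ω x (bracket Y Z x) (X x) = 0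

/-- `D^r_X(Y) = (ℒ_Y r)(X) = [Y, r(X)] - r([Y, X])`. -/
def opD (r : Tensor11 E M) (X Y : VField E M) : VField E M :=
  bracket Y (appV r X) - appV r (bracket Y X)

/-- `D^{r,*}_X(α) = ℒ_X(r^* α) - ℒ_{r(X)} α`. -/
def opDStar (r : Tensor11 E M) (X : VField E M) (α : OneForm E M) : OneForm E M :=
  lieDer X (appF r α) - lieDer (appV r X) α

/-- `r` is a Nijenhuis operator: the torsion
`[r X, r Y] - r([r X, Y] + [X, r Y] - r[X, Y])` vanishes for all smooth vector fields. -/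
def IsNijenhuis [IsManifold 𝓘(ℝ, E) ∞ M] (r : Tensor11 E M) : Prop :=
  ∀ X Y : VField E M, SmoothVField X → SmoothVField Y → ∀ x : M,
    bracket (appV r X) (appV r Y) x
      - r x (bracket (appV r X) Y x + bracket X (appV r Y) x - r x (bracket X Y x)) = 0

/-! ### Dirac structures -/

variable (E) in
/-- The fibre of the generalized tangent bundle `𝕋M = TM ⊕ T*M` at `x`. -/
abbrev GTan (x : M) : Type _ := Tan E x × Cot E x

variable (E M) in
/-- A family of linear subspaces of the fibres of `𝕋M`. -/
abbrev SubFamily : Type _ := ∀ x : M, Submodule ℝ (GTan E x)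

/-- The pairing `⟨(X, α), (Y, β)⟩ = β(X) + α(Y)`. -/
def pairing {x : M} (p q : GTan E x) : ℝ := q.2 p.1 + p.2 q.1

/-- `L` is a smooth vector subbundle of `𝕋M`: near each point it has a smooth local frame. -/
def IsSubbundle [IsManifold 𝓘(ℝ, E) ∞ M] (L : SubFamily E M) : Prop :=
  ∀ x₀ : M, ∃ U : Set M, IsOpen U ∧ x₀ ∈ U ∧
    ∃ (k : ℕ) (X : Fin k → VField E M) (α : Fin k → OneForm E M),
      (∀ i, SmoothVFieldOn (X i) U) ∧ (∀ i, SmoothOneFormOn (α i) U) ∧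
      ∀ x ∈ U, LinearIndependent ℝ (fun i => ((X i x, α i x) : GTan E x)) ∧
        Submodule.span ℝ (Set.range fun i => ((X i x, α i x) : GTan E x)) = L x

/-- `L` is a lagrangian subbundle: a smooth subbundle with `L = L^⊥`. -/
structure IsLagrangian [IsManifold 𝓘(ℝ, E) ∞ M] (L : SubFamily E M) : Prop where
  subbundle : IsSubbundle L
  mem_iff : ∀ (x : M) (p : GTan E x), p ∈ L x ↔ ∀ q ∈ L x, pairing p q = 0

/-- `(X, α) ∈ Γ(L)`. -/
structure IsSection [IsManifold 𝓘(ℝ, E) ∞ M] (L : SubFamily E M)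
    (X : VField E M) (α : OneForm E M) : Prop where
  smooth_left : SmoothVField X
  smooth_right : SmoothOneForm α
  mem : ∀ x : M, ((X x, α x) : GTan E x) ∈ L x

/-- `L` is a Dirac structure: a lagrangian subbundle that is involutive with respect to the
Courant–Dorfman bracket `⟦(X, α), (Y, β)⟧ = ([X, Y], ℒ_X β - i_Y dα)`. -/
structure IsDirac [IsManifold 𝓘(ℝ, E) ∞ M] (L : SubFamily E M) : Prop extends
    IsLagrangian L where
  involutive : ∀ (X Y : VField E M) (α β : OneForm E M), IsSection L X α → IsSection L Y β →
    ∀ x : M, ((bracket X Y x, (lieDer X β - iExtDeriv Y α) x) : GTan E x) ∈ L x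

/-- The pair `(L, r)` is compatible: `(r, r^*)(L) ⊆ L`, and
`(D^r_X, D^{r,*}_X)(Γ(L)) ⊆ Γ(L)` for all `X ∈ 𝔛(M)`. (For smooth `r`, these operators map smooth
sections of `𝕋M` to smooth sections, so only membership in `L` is to be required.) -/
structure IsCompatible [IsManifold 𝓘(ℝ, E) ∞ M] (L : SubFamily E M) (r : Tensor11 E M) :
    Prop where
  map_mem : ∀ (x : M) (p : GTan E x), p ∈ L x → ((r x p.1, p.2.comp (r x)) : GTan E x) ∈ L x
  deriv_mem : ∀ (X Y : VField E M) (α : OneForm E M), SmoothVField X → IsSection L Y α →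
    ∀ x : M, ((opD r X Y x, opDStar r X α x) : GTan E x) ∈ L x

/-- `(L, r)` is a Dirac–Nijenhuis structure. -/
structure IsDiracNijenhuis [IsManifold 𝓘(ℝ, E) ∞ M] (L : SubFamily E M) (r : Tensor11 E M) :
    Prop where
  dirac : IsDirac L
  smooth : SmoothTensor11 r
  nijenhuis : IsNijenhuis r
  compatible : IsCompatible L r

/-- The graph `{(u, Ω♭(u))}` of `Ω♭ : TM → T*M`. -/
def graph (Ω : BilinField E M) : SubFamily E M := fun x => LinearMap.graph (Ω x).toLinearMap

/-- The pair `(Ω, r)` is compatible: `Ω♭ ∘ r = r^* ∘ Ω♭`, and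
`D^{r,*}_X(Ω♭(Y)) = Ω♭(D^r_X(Y))` for all `X, Y ∈ 𝔛(M)`. -/
structure IsFormCompatible [IsManifold 𝓘(ℝ, E) ∞ M] (Ω : BilinField E M) (r : Tensor11 E M) :
    Prop where
  comm : ∀ (x : M) (u : Tan E x), Ω x (r x u) = (Ω x u).comp (r x)
  deriv : ∀ X Y : VField E M, SmoothVField X → SmoothVField Y → ∀ x : M,
    opDStar r X (fun y => Ω y (Y y)) x = Ω x (opD r X Y x)

/-- `(Ω, r)` is a presymplectic–Nijenhuis structure. -/
structure IsPresymplecticNijenhuis [IsManifold 𝓘(ℝ, E) ∞ M] (Ω : BilinField E M)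
    (r : Tensor11 E M) : Prop where
  twoForm : IsTwoForm Ω
  closed : IsClosedTwoForm Ω
  smooth : SmoothTensor11 r
  nijenhuis : IsNijenhuis r
  compatible : IsFormCompatible Ω r

end Basic

/-! ### Maps -/

section Maps

variable {E : Type*} [NormedAddCommGroup E] [NormedSpace ℝ E]
  {F : Type*} [NormedAddCommGroup F] [NormedSpace ℝ F]
  {N : Type*} [TopologicalSpace N] [ChartedSpace E N]
  {M : Type*} [TopologicalSpace M] [ChartedSpace F M]

variable (E F) in
/-- The tangent map `T_x ψ : T_x N → T_{ψ(x)} M`. -/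
def tmap (ψ : N → M) (x : N) : Tan E x →L[ℝ] Tan F (ψ x) := mfderiv 𝓘(ℝ, E) 𝓘(ℝ, F) ψ x

/-- The backward image `{(X, (T_x ψ)^* β) | (T_x ψ (X), β) ∈ L_{ψ(x)}}` of `L` along `ψ`. -/
def backward (ψ : N → M) (L : SubFamily F M) : SubFamily E N := fun x =>
  { carrier := {p | ∃ β : Cot F (ψ x),
      ((tmap E F ψ x p.1, β) : GTan F (ψ x)) ∈ L (ψ x) ∧ p.2 = β.comp (tmap E F ψ x)}
    add_mem' := by
      rintro p q ⟨β, hβ, hp⟩ ⟨γ, hγ, hq⟩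
      refine ⟨β + γ, ?_, ?_⟩
      · have h := (L (ψ x)).add_mem hβ hγ
        rw [Prod.mk_add_mk, ← map_add] at h
        exact h
      · rw [Prod.snd_add, hp, hq]; exact (ContinuousLinearMap.add_comp β γ _).symm
    zero_mem' := by
      refine ⟨0, ?_, ?_⟩
      · have h := (L (ψ x)).zero_mem
        rw [Prod.fst_zero, map_zero]; exact h
      · exact (ContinuousLinearMap.zero_comp _).symm
    smul_mem' := by
      rintro c p ⟨β, hβ, hp⟩
      refine ⟨c • β, ?_, ?_⟩
      · have h := (L (ψ x)).smul_mem c hβ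
        rw [Prod.smul_mk, ← map_smul] at h
        exact h
      · rw [Prod.smul_snd, hp]; exact (ContinuousLinearMap.smul_comp c β _).symm }

/-- `ψ : (N, L_N) → (M, L_M)` is a backward Dirac map. -/
def IsBackwardDirac (ψ : N → M) (LN : SubFamily E N) (LM : SubFamily F M) : Prop :=
  ∀ x : N, LN x = backward ψ LM x

/-- `r_N` and `r_M` are `ψ`-related: `r_M ∘ dψ = dψ ∘ r_N`. -/
def AreRelated (ψ : N → M) (rN : Tensor11 E N) (rM : Tensor11 F M) : Prop :=
  ∀ (x : N) (v : Tan E x), rM (ψ x) (tmap E F ψ x v) = tmap E F ψ x (rN x v)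

variable (E F) in
/-- `ψ : N → M` exhibits `N` as an (immersed) submanifold of `M`: `ψ` is an injective
immersion. -/
structure IsSubmanifold (ψ : N → M) : Prop where
  smooth : ContMDiff 𝓘(ℝ, E) 𝓘(ℝ, F) ∞ ψ
  injective : Function.Injective ψ
  immersion : ∀ x : N, Function.Injective (tmap E F ψ x)

variable (E) in
/-- The submanifold `ψ : N → M` is `r`-invariant: `r(TN) ⊆ TN`. -/
def IsInvariant (ψ : N → M) (r : Tensor11 F M) : Prop :=
  ∀ (x : N) (v : Tan E x), ∃ w : Tan E x, tmap E F ψ x w = r (ψ x) (tmap E F ψ x v)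

variable (E) in
/-- The submanifold `ψ : N → M` is an integral submanifold of the (singular) foliation defined by
`L`: its tangent spaces are `pr_T(L)`. The presymplectic leaves of `L` are the maximal connected
integral submanifolds. -/
def IsIntegral (ψ : N → M) (L : SubFamily F M) : Prop :=
  ∀ (x : N) (u : Tan F (ψ x)),
    (∃ v : Tan E x, tmap E F ψ x v = u) ↔
      ∃ β : Cot F (ψ x), ((u, β) : GTan F (ψ x)) ∈ L (ψ x)

end Maps

end DiracGeom

end

/-!
Let `L` be a Dirac structure on `M`, compatible with `r_M`, let `ψ : N → M` be smooth, and let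
`B` be the backward image of `L` along `ψ`.

If a section `(Y, α)` of `B` can be written near a point as `dψ(Y) = ∑ fᵢ (Yᵢ ∘ ψ)` and
`α = ∑ fᵢ ψ^*αᵢ`, with sections `(Yᵢ, αᵢ)` of `L` and smooth functions `fᵢ`, then the Leibniz
rules for the Courant–Dorfman bracket and for `(D^r, D^{r,*})`, together with naturality under
`ψ`, express brackets and derivatives of such sections by pull-backs of elements of `L`; they
therefore lie in `B` at that point (`IsRegularPoint.courant_mem`, `IsRegularPoint.opD_mem`). Such
a smooth decomposition exists wherever the rank of the pulled back family `(Xᵢ ∘ ψ, ψ^*αᵢ)`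
spanning `L` is locally maximal. Points of this kind need not be all of `N`, but they are dense
(`dense_isRegularPoint`). If `B` is a lagrangian subbundle, membership in `B` is the vanishing of
finitely many pairings with smooth sections, so it extends from a dense set to `N` by continuity
(`IsLagrangian.mem_of_dense`). This gives both the involutivity of `B` (`IsDirac.backward`) and its
compatibility with any tensor related to `r_M` (`IsCompatible.backward`). That `B = B^⊥` in each
fibre is linear algebra (`backward_maximal`).

On an invariant submanifold, `r_M` restricts to a smooth tensor because a smooth family of
injective linear maps has smooth left inverses (`exists_restrict`); its torsion is related to that
of `r_M`, and `dψ` is injective, so it is Nijenhuis if `r_M` is (`IsNijenhuis.of_areRelated`).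

If the tangent spaces of `N` are the projections of `L`, then `Ω(v) = β ∘ dψ`, for any `β` with
`(dψ(v), β) ∈ L`, is well defined by isotropy, and its graph is `B`. It is smooth since the
projections of sections of `L` span the constant-rank image of `dψ` (`IsIntegral.isTwoForm`), and
involutivity and compatibility of the graph translate into closedness of `Ω` and its compatibility
with the restricted tensor.
-/

noncomputable section

namespace DiracGeom

open Filter Topology

/-! ### Linear equations depending smoothly on a parameter -/

section Solve

variable {E F G : Type*} [NormedAddCommGroup E] [NormedSpace ℝ E]
  [NormedAddCommGroup F] [NormedSpace ℝ F] [FiniteDimensional ℝ F]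
  [NormedAddCommGroup G] [NormedSpace ℝ G] [FiniteDimensional ℝ G]

/-- An injective linear map depending smoothly on a parameter has a smooth family of left
inverses near the given parameter value. -/
theorem exists_smooth_leftInverse {P : E → F →L[ℝ] G} {e₀ : E} (hP : ContDiffAt ℝ ∞ P e₀)
    (hinj : Function.Injective (P e₀)) :
    ∃ B : E → G →L[ℝ] F, ContDiffAt ℝ ∞ B e₀ ∧
      ∀ᶠ e in 𝓝 e₀, (B e).comp (P e) = ContinuousLinearMap.id ℝ F := by
  obtain ⟨B₀, hB₀⟩ : ∃ B₀ : G →L[ℝ] F, B₀.comp (P e₀) = ContinuousLinearMap.id ℝ F := by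
    obtain ⟨b, hb⟩ := (P e₀).toLinearMap.exists_leftInverse_of_injective
      (LinearMap.ker_eq_bot.2 hinj)
    refine ⟨LinearMap.toContinuousLinearMap b, ?_⟩
    ext v
    exact LinearMap.congr_fun hb v
  have : CompleteSpace F := FiniteDimensional.complete ℝ F
  have hC : ContDiffAt ℝ ∞ (fun e => B₀.comp (P e)) e₀ := contDiffAt_const.clm_comp hP
  have hinv : ContDiffAt ℝ ∞ (fun e => (B₀.comp (P e)).inverse) e₀ := by
    have h := contDiffAt_map_inverse (𝕜 := ℝ) (n := ∞) (ContinuousLinearEquiv.refl ℝ F)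
    refine ContDiffAt.comp (g := ContinuousLinearMap.inverse) e₀ ?_ hC
    rw [hB₀]
    exact h
  refine ⟨fun e => (B₀.comp (P e)).inverse.comp B₀, hinv.clm_comp contDiffAt_const, ?_⟩
  have hev : ∀ᶠ e in 𝓝 e₀, B₀.comp (P e) ∈
      Set.range ((↑) : (F ≃L[ℝ] F) → F →L[ℝ] F) := by
    refine hC.continuousAt.eventually_mem ?_
    rw [hB₀]
    exact ContinuousLinearEquiv.nhds (ContinuousLinearEquiv.refl ℝ F)
  filter_upwards [hev] with e ⟨u, hu⟩
  rw [ContinuousLinearMap.comp_assoc, ← hu, ContinuousLinearMap.inverse_equiv]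
  ext v
  simp

/-- If the rank of a smooth family of vectors does not increase near `e₀`, then smooth functions
with values in its span are smooth combinations of the family. -/
theorem exists_smooth_coeff {k : ℕ} {v : Fin k → E → G} {e₀ : E}
    (hv : ∀ i, ContDiffAt ℝ ∞ (v i) e₀)
    (hrank : ∀ᶠ e in 𝓝 e₀, Module.finrank ℝ (Submodule.span ℝ (Set.range fun i => v i e)) ≤
      Module.finrank ℝ (Submodule.span ℝ (Set.range fun i => v i e₀)))
    {b : E → G} (hb : ContDiffAt ℝ ∞ b e₀)
    (hmem : ∀ᶠ e in 𝓝 e₀, b e ∈ Submodule.span ℝ (Set.range fun i => v i e)) :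
    ∃ f : Fin k → E → ℝ, (∀ i, ContDiffAt ℝ ∞ (f i) e₀) ∧
      ∀ᶠ e in 𝓝 e₀, b e = ∑ i, f i e • v i e := by
  classical
  obtain ⟨κ, a, ha, hspan, hli⟩ := exists_linearIndependent' ℝ (fun i => v i e₀)
  have : Fintype κ := Fintype.ofInjective a ha
  let P : E → (κ → ℝ) →L[ℝ] G := fun e =>
    ∑ j, (ContinuousLinearMap.proj (R := ℝ) (φ := fun _ : κ => ℝ) j).smulRight (v (a j) e)
  have hPapp : ∀ e c, P e c = ∑ j, c j • v (a j) e := by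
    intro e c
    simp [P]
  have hP : ContDiffAt ℝ ∞ P e₀ :=
    ContDiffAt.sum fun j _ => contDiffAt_const.smulRight (hv (a j))
  have hinj : Function.Injective (P e₀) := by
    refine (injective_iff_map_eq_zero _).2 fun c hc => ?_
    rw [hPapp] at hc
    exact funext fun j => (Fintype.linearIndependent_iff.1 hli) c hc j
  obtain ⟨B, hB, hBP⟩ := exists_smooth_leftInverse hP hinj
  -- The coefficients are those with respect to a subfamily that is a basis of the span at `e₀`;
  -- since the rank does not increase, it stays a basis of the span nearby.
  refine ⟨fun i e => ∑ j, if a j = i then B e (b e) j else 0, fun i => ?_, ?_⟩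
  · refine ContDiffAt.sum fun j _ => ?_
    split_ifs
    · exact contDiffAt_pi.1 (hB.clm_apply hb) j
    · exact contDiffAt_const
  filter_upwards [hrank, hmem, hBP] with e her hem heB
  have hlie : LinearIndependent ℝ (fun j => v (a j) e) := by
    refine Fintype.linearIndependent_iff.2 fun c hc => ?_
    rw [← hPapp] at hc
    have := congrArg (fun T => T c) heB
    simp only [ContinuousLinearMap.comp_apply, hc, map_zero] at this
    exact fun j => (congrFun this j).symm
  have hsub : Submodule.span ℝ (Set.range fun j => v (a j) e) =
      Submodule.span ℝ (Set.range fun i => v i e) := by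
    refine Submodule.eq_of_le_of_finrank_le
      (Submodule.span_mono (Set.range_comp_subset_range a fun i => v i e)) ?_
    rw [finrank_span_eq_card hlie]
    refine her.trans (le_of_eq ?_)
    rw [← hspan]
    exact finrank_span_eq_card hli
  rw [← hsub] at hem
  obtain ⟨c, hc⟩ := (Submodule.mem_span_range_iff_exists_fun ℝ).1 hem
  have hBc : B e (b e) = c := by
    rw [← hc, ← hPapp]
    exact congrArg (fun T => T c) heB
  rw [hBc, ← hc]
  simp_rw [Finset.sum_smul, ite_smul, zero_smul]
  rw [Finset.sum_comm]
  simp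

end Solve

/-! ### Local formulas -/

section Local

variable {E F : Type*} [NormedAddCommGroup E] [NormedSpace ℝ E]
  [NormedAddCommGroup F] [NormedSpace ℝ F]

/-- Coordinate expression of `D^r_X(Y)` at `e`, which depends only on the value `x` of `X`. -/
def locD (r : E → E →L[ℝ] E) (x : E) (Y : E → E) (e : E) : E :=
  fderiv ℝ r e (Y e) x - fderiv ℝ Y e (r e x) + r e (fderiv ℝ Y e x)

/-- Coordinate expression of `D^{r,*}_X(α)` at `e`, which depends only on the value `x` of `X`. -/
def locDStar (r : E → E →L[ℝ] E) (x : E) (a : E → E →L[ℝ] ℝ) (e : E) : E →L[ℝ] ℝ :=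
  (fderiv ℝ a e x).comp (r e) - fderiv ℝ a e (r e x) +
    (a e).comp (fderiv ℝ r e x - (fderiv ℝ r e).flip x)

/-- Coordinate expression of the `1`-form component `ℒ_X β - i_Y dα` of the Courant–Dorfman
bracket of `(X, α)` and `(Y, β)`. -/
def locCourant (X : E → E) (a : E → E →L[ℝ] ℝ) (Y : E → E) (b : E → E →L[ℝ] ℝ) (e : E) :
    E →L[ℝ] ℝ :=
  fderiv ℝ b e (X e) + (b e).comp (fderiv ℝ X e) - fderiv ℝ a e (Y e) + (fderiv ℝ a e).flip (Y e)

/-- Coordinate expression of the torsion of `r` at `e`. -/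
def locTorsion (r : E → E →L[ℝ] E) (x y : E) (e : E) : E :=
  fderiv ℝ r e (r e x) y - fderiv ℝ r e (r e y) x + r e (fderiv ℝ r e y x) -
    r e (fderiv ℝ r e x y)

theorem locDStar_apply (r : E → E →L[ℝ] E) (x : E) (a : E → E →L[ℝ] ℝ) (e v : E) :
    locDStar r x a e v = fderiv ℝ a e x (r e v) - fderiv ℝ a e (r e x) v +
      (a e (fderiv ℝ r e x v) - a e (fderiv ℝ r e v x)) := by
  simp [locDStar]

theorem locCourant_apply (X : E → E) (a : E → E →L[ℝ] ℝ) (Y : E → E) (b : E → E →L[ℝ] ℝ)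
    (e v : E) :
    locCourant X a Y b e v = fderiv ℝ b e (X e) v + b e (fderiv ℝ X e v) -
      fderiv ℝ a e (Y e) v + fderiv ℝ a e v (Y e) := rfl

variable {ψ : E → F} {r : E → E →L[ℝ] E} {R : F → F →L[ℝ] F} {e : E}

theorem differentiableAt_fderiv_of_contDiffAt (hψ : ContDiffAt ℝ ∞ ψ e) :
    DifferentiableAt ℝ (fderiv ℝ ψ) e :=
  (hψ.fderiv_right (m := ∞) (by simp)).differentiableAt (by simp)

theorem fderiv_fderiv_symm (hψ : ContDiffAt ℝ ∞ ψ e) (u v : E) :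
    fderiv ℝ (fderiv ℝ ψ) e u v = fderiv ℝ (fderiv ℝ ψ) e v u :=
  (hψ.isSymmSndFDerivAt (by simpa using ENat.LEInfty.out)).eq u v

/-- The derivative of the relation `R ∘ dψ = dψ ∘ r`. -/
theorem fderiv_related (hψ : ContDiffAt ℝ ∞ ψ e) (hr : DifferentiableAt ℝ r e)
    (hR : DifferentiableAt ℝ R (ψ e))
    (hrel : ∀ᶠ z in 𝓝 e, (R (ψ z)).comp (fderiv ℝ ψ z) = (fderiv ℝ ψ z).comp (r z)) (u v : E) :
    fderiv ℝ R (ψ e) (fderiv ℝ ψ e u) (fderiv ℝ ψ e v) + R (ψ e) (fderiv ℝ (fderiv ℝ ψ) e u v) =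
      fderiv ℝ (fderiv ℝ ψ) e u (r e v) + fderiv ℝ ψ e (fderiv ℝ r e u v) := by
  have hψ' := (hψ.differentiableAt (by simp)).hasFDerivAt
  have h2 := (differentiableAt_fderiv_of_contDiffAt hψ).hasFDerivAt
  have hRψ : HasFDerivAt (fun z => R (ψ z)) ((fderiv ℝ R (ψ e)).comp (fderiv ℝ ψ e)) e :=
    hR.hasFDerivAt.comp e hψ'
  have h3 := hRψ.clm_comp h2
  have h4 := h2.clm_comp hr.hasFDerivAt
  have h5 := (h3.congr_of_eventuallyEq (hrel.mono fun z hz => hz.symm)).unique h4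
  have h6 := congrArg (fun T => T u v) h5
  simp at h6
  rw [add_comm] at h6
  rw [h6, add_comm]

/-- The derivative of a relation `dψ(Y) = ∑ fᵢ (Yᵢ ∘ ψ)`. -/
theorem fderiv_decomp_left {k : ℕ} {Y : E → E} {Yi : Fin k → F → F} {f : Fin k → E → ℝ}
    (hψ : ContDiffAt ℝ ∞ ψ e) (hY : DifferentiableAt ℝ Y e)
    (hYi : ∀ i, DifferentiableAt ℝ (Yi i) (ψ e)) (hf : ∀ i, DifferentiableAt ℝ (f i) e)
    (hdec : ∀ᶠ z in 𝓝 e, fderiv ℝ ψ z (Y z) = ∑ i, f i z • Yi i (ψ z)) (u : E) :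
    fderiv ℝ ψ e (fderiv ℝ Y e u) =
      ∑ i, (fderiv ℝ (f i) e u • Yi i (ψ e) + f i e • fderiv ℝ (Yi i) (ψ e) (fderiv ℝ ψ e u))
        - fderiv ℝ (fderiv ℝ ψ) e u (Y e) := by
  have hψ' := (hψ.differentiableAt (by simp)).hasFDerivAt
  have h2 := (differentiableAt_fderiv_of_contDiffAt hψ).hasFDerivAt
  have h3 := h2.clm_apply hY.hasFDerivAt
  have h4 : HasFDerivAt (fun z => ∑ i, f i z • Yi i (ψ z)) _ e := HasFDerivAt.fun_sum fun i _ =>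
    (hf i).hasFDerivAt.smul ((hYi i).hasFDerivAt.comp e hψ')
  have h5 := (h3.congr_of_eventuallyEq (hdec.mono fun z hz => hz.symm)).unique h4
  have h6 := congrArg (fun T => T u) h5
  simp at h6
  rw [eq_sub_iff_add_eq, h6]
  exact Finset.sum_congr rfl fun i _ => add_comm _ _

/-- The derivative of a relation `α = ∑ fᵢ ψ^*βᵢ`. -/
theorem fderiv_decomp_right {k : ℕ} {a : E → E →L[ℝ] ℝ} {b : Fin k → F → F →L[ℝ] ℝ}
    {f : Fin k → E → ℝ} (hψ : ContDiffAt ℝ ∞ ψ e)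
    (hb : ∀ i, DifferentiableAt ℝ (b i) (ψ e)) (hf : ∀ i, DifferentiableAt ℝ (f i) e)
    (hdec : ∀ᶠ z in 𝓝 e, a z = ∑ i, f i z • (b i (ψ z)).comp (fderiv ℝ ψ z)) (u v : E) :
    fderiv ℝ a e u v =
      ∑ i, (fderiv ℝ (f i) e u * b i (ψ e) (fderiv ℝ ψ e v) +
        f i e * fderiv ℝ (b i) (ψ e) (fderiv ℝ ψ e u) (fderiv ℝ ψ e v) +
        f i e * b i (ψ e) (fderiv ℝ (fderiv ℝ ψ) e u v)) := by
  have hψ' := (hψ.differentiableAt (by simp)).hasFDerivAt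
  have h2 := (differentiableAt_fderiv_of_contDiffAt hψ).hasFDerivAt
  have h4 : HasFDerivAt (fun z => ∑ i, f i z • (b i (ψ z)).comp (fderiv ℝ ψ z)) _ e :=
    HasFDerivAt.fun_sum fun i _ => (hf i).hasFDerivAt.smul
      ((show HasFDerivAt (fun z => b i (ψ z)) _ e from
        (hb i).hasFDerivAt.comp e hψ').clm_comp h2)
  rw [(h4.congr_of_eventuallyEq hdec).fderiv]
  simp
  exact Finset.sum_congr rfl fun i _ => by ring

/-- The operator `D^r` along `ψ`, on a section of the form `∑ fᵢ (Yᵢ ∘ ψ)`. -/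
theorem fderiv_locD {k : ℕ} {Y : E → E} {Yi : Fin k → F → F} {f : Fin k → E → ℝ} {x : E}
    (hψ : ContDiffAt ℝ ∞ ψ e) (hr : DifferentiableAt ℝ r e) (hR : DifferentiableAt ℝ R (ψ e))
    (hrel : ∀ᶠ z in 𝓝 e, (R (ψ z)).comp (fderiv ℝ ψ z) = (fderiv ℝ ψ z).comp (r z))
    (hY : DifferentiableAt ℝ Y e)
    (hYi : ∀ i, DifferentiableAt ℝ (Yi i) (ψ e)) (hf : ∀ i, DifferentiableAt ℝ (f i) e)
    (hdec : ∀ᶠ z in 𝓝 e, fderiv ℝ ψ z (Y z) = ∑ i, f i z • Yi i (ψ z)) :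
    fderiv ℝ ψ e (locD r x Y e) =
      ∑ i, (f i e • locD R (fderiv ℝ ψ e x) (Yi i) (ψ e) +
        fderiv ℝ (f i) e x • R (ψ e) (Yi i (ψ e)) - fderiv ℝ (f i) e (r e x) • Yi i (ψ e)) := by
  have h1 := fderiv_related hψ hr hR hrel (Y e) x
  have h2 := fderiv_decomp_left hψ hY hYi hf hdec (r e x)
  have h3 := fderiv_decomp_left hψ hY hYi hf hdec x
  have h4 : ∀ v, R (ψ e) (fderiv ℝ ψ e v) = fderiv ℝ ψ e (r e v) := fun v =>
    congrArg (fun T => T v) hrel.self_of_nhds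
  have h5 := hdec.self_of_nhds
  have h6 : fderiv ℝ ψ e (fderiv ℝ r e (Y e) x) =
      ∑ i, f i e • fderiv ℝ R (ψ e) (Yi i (ψ e)) (fderiv ℝ ψ e x) +
        R (ψ e) (fderiv ℝ (fderiv ℝ ψ) e (Y e) x) - fderiv ℝ (fderiv ℝ ψ) e (Y e) (r e x) := by
    rw [eq_sub_iff_add_eq, add_comm, ← h1, h5]
    simp
  simp only [locD, map_add, map_sub, h6, h2, ← h4, h3, map_sum, map_smul, smul_add, smul_sub,
    Finset.sum_add_distrib, Finset.sum_sub_distrib, fderiv_fderiv_symm hψ (Y e)]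
  module

/-- The operator `D^{r,*}` on a `1`-form `∑ fᵢ ψ^*βᵢ`. -/
theorem locDStar_decomp {k : ℕ} {a : E → E →L[ℝ] ℝ} {b : Fin k → F → F →L[ℝ] ℝ}
    {f : Fin k → E → ℝ} {x : E}
    (hψ : ContDiffAt ℝ ∞ ψ e) (hr : DifferentiableAt ℝ r e) (hR : DifferentiableAt ℝ R (ψ e))
    (hrel : ∀ᶠ z in 𝓝 e, (R (ψ z)).comp (fderiv ℝ ψ z) = (fderiv ℝ ψ z).comp (r z))
    (hb : ∀ i, DifferentiableAt ℝ (b i) (ψ e)) (hf : ∀ i, DifferentiableAt ℝ (f i) e)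
    (hdec : ∀ᶠ z in 𝓝 e, a z = ∑ i, f i z • (b i (ψ z)).comp (fderiv ℝ ψ z)) :
    locDStar r x a e =
      (∑ i, (f i e • locDStar R (fderiv ℝ ψ e x) (b i) (ψ e) +
        fderiv ℝ (f i) e x • (b i (ψ e)).comp (R (ψ e)) -
          fderiv ℝ (f i) e (r e x) • b i (ψ e))).comp (fderiv ℝ ψ e) := by
  ext v
  have h1 := fderiv_related hψ hr hR hrel v x
  have h2 := fderiv_related hψ hr hR hrel x v
  have h4 : ∀ v, fderiv ℝ ψ e (r e v) = R (ψ e) (fderiv ℝ ψ e v) := fun v =>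
    (congrArg (fun T => T v) hrel.self_of_nhds).symm
  have h5 : ∀ w, a e w = ∑ i, f i e * b i (ψ e) (fderiv ℝ ψ e w) := fun w => by
    rw [hdec.self_of_nhds]; simp
  have h7 : fderiv ℝ ψ e (fderiv ℝ r e x v - fderiv ℝ r e v x) =
      fderiv ℝ R (ψ e) (fderiv ℝ ψ e x) (fderiv ℝ ψ e v)
        - fderiv ℝ R (ψ e) (fderiv ℝ ψ e v) (fderiv ℝ ψ e x)
        - fderiv ℝ (fderiv ℝ ψ) e x (r e v) + fderiv ℝ (fderiv ℝ ψ) e (r e x) v := by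
    rw [map_sub, eq_sub_of_add_eq' h1.symm, eq_sub_of_add_eq' h2.symm,
      fderiv_fderiv_symm hψ (r e x) v, fderiv_fderiv_symm hψ v x]
    abel
  simp only [locDStar, add_apply, sub_apply,
    ContinuousLinearMap.comp_apply, ContinuousLinearMap.flip_apply, h5, h7,
    fderiv_decomp_right hψ hb hf hdec, h4]
  simp only [sum_apply, add_apply, sub_apply,
    smul_apply, smul_eq_mul, ContinuousLinearMap.comp_apply,
    ContinuousLinearMap.flip_apply, map_add, map_sub, ← Finset.sum_sub_distrib,
    ← Finset.sum_add_distrib]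
  exact Finset.sum_congr rfl fun i _ => by ring

/-- The torsions of related tensors are related. -/
theorem fderiv_locTorsion {x y : E}
    (hψ : ContDiffAt ℝ ∞ ψ e) (hr : DifferentiableAt ℝ r e) (hR : DifferentiableAt ℝ R (ψ e))
    (hrel : ∀ᶠ z in 𝓝 e, (R (ψ z)).comp (fderiv ℝ ψ z) = (fderiv ℝ ψ z).comp (r z)) :
    fderiv ℝ ψ e (locTorsion r x y e) =
      locTorsion R (fderiv ℝ ψ e x) (fderiv ℝ ψ e y) (ψ e) := by
  have h1 := fun u v => (eq_sub_of_add_eq' (fderiv_related hψ hr hR hrel u v).symm)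
  have h4 : ∀ v, fderiv ℝ ψ e (r e v) = R (ψ e) (fderiv ℝ ψ e v) := fun v =>
    (congrArg (fun T => T v) hrel.self_of_nhds).symm
  simp only [locTorsion, map_sub, map_add, h1, h4]
  rw [fderiv_fderiv_symm hψ (r e x) y, fderiv_fderiv_symm hψ (r e y) x, fderiv_fderiv_symm hψ y x,
    fderiv_fderiv_symm hψ (r e x) (r e y)]
  abel

variable {k : ℕ} {X Y : E → E} {a b : E → E →L[ℝ] ℝ} {Xi : Fin k → F → F}
  {ai : Fin k → F → F →L[ℝ] ℝ} {f g : Fin k → E → ℝ}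

/-- The Lie bracket of vector fields of the form `∑ fᵢ (Xᵢ ∘ ψ)` and `∑ gⱼ (Xⱼ ∘ ψ)` along `ψ`. -/
theorem fderiv_lieBracket_decomp (hψ : ContDiffAt ℝ ∞ ψ e)
    (hX : DifferentiableAt ℝ X e) (hY : DifferentiableAt ℝ Y e)
    (hXi : ∀ i, DifferentiableAt ℝ (Xi i) (ψ e))
    (hf : ∀ i, DifferentiableAt ℝ (f i) e) (hg : ∀ i, DifferentiableAt ℝ (g i) e)
    (hdX : ∀ᶠ z in 𝓝 e, fderiv ℝ ψ z (X z) = ∑ i, f i z • Xi i (ψ z))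
    (hdY : ∀ᶠ z in 𝓝 e, fderiv ℝ ψ z (Y z) = ∑ i, g i z • Xi i (ψ z)) :
    fderiv ℝ ψ e (VectorField.lieBracket ℝ X Y e) =
      ∑ j, fderiv ℝ (g j) e (X e) • Xi j (ψ e) - ∑ i, fderiv ℝ (f i) e (Y e) • Xi i (ψ e) +
        ∑ i, ∑ j, (f i e * g j e) • VectorField.lieBracket ℝ (Xi i) (Xi j) (ψ e) := by
  have h1 : ∑ j, g j e • fderiv ℝ (Xi j) (ψ e) (fderiv ℝ ψ e (X e)) =
      ∑ i, ∑ j, (f i e * g j e) • fderiv ℝ (Xi j) (ψ e) (Xi i (ψ e)) := by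
    rw [hdX.self_of_nhds, Finset.sum_comm]
    simp [Finset.smul_sum, smul_smul, mul_comm]
  have h2 : ∑ i, f i e • fderiv ℝ (Xi i) (ψ e) (fderiv ℝ ψ e (Y e)) =
      ∑ i, ∑ j, (f i e * g j e) • fderiv ℝ (Xi i) (ψ e) (Xi j (ψ e)) := by
    rw [hdY.self_of_nhds]
    simp [Finset.smul_sum, smul_smul]
  rw [VectorField.lieBracket, map_sub, fderiv_decomp_left hψ hY hXi hg hdY,
    fderiv_decomp_left hψ hX hXi hf hdX]
  simp only [VectorField.lieBracket, smul_sub, Finset.sum_sub_distrib, Finset.sum_add_distrib,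
    h1, h2]
  rw [fderiv_fderiv_symm hψ (X e)]
  abel

/-- The `1`-form part of the Courant–Dorfman bracket of sections which are smooth combinations of
the pull-back of an isotropic family. -/
theorem locCourant_decomp (hψ : ContDiffAt ℝ ∞ ψ e)
    (hX : DifferentiableAt ℝ X e)
    (hXi : ∀ i, DifferentiableAt ℝ (Xi i) (ψ e)) (hai : ∀ i, DifferentiableAt ℝ (ai i) (ψ e))
    (hf : ∀ i, DifferentiableAt ℝ (f i) e) (hg : ∀ i, DifferentiableAt ℝ (g i) e)
    (hdX : ∀ᶠ z in 𝓝 e, fderiv ℝ ψ z (X z) = ∑ i, f i z • Xi i (ψ z))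
    (hdY : ∀ᶠ z in 𝓝 e, fderiv ℝ ψ z (Y z) = ∑ i, g i z • Xi i (ψ z))
    (hda : ∀ᶠ z in 𝓝 e, a z = ∑ i, f i z • (ai i (ψ z)).comp (fderiv ℝ ψ z))
    (hdb : ∀ᶠ z in 𝓝 e, b z = ∑ i, g i z • (ai i (ψ z)).comp (fderiv ℝ ψ z))
    (hiso : ∀ i j, ai j (ψ e) (Xi i (ψ e)) + ai i (ψ e) (Xi j (ψ e)) = 0) :
    locCourant X a Y b e =
      (∑ j, fderiv ℝ (g j) e (X e) • ai j (ψ e) - ∑ i, fderiv ℝ (f i) e (Y e) • ai i (ψ e) +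
        ∑ i, ∑ j, (f i e * g j e) • locCourant (Xi i) (ai i) (Xi j) (ai j) (ψ e)).comp
          (fderiv ℝ ψ e) := by
  ext v
  have A1 : fderiv ℝ b e (X e) v =
      ∑ j, fderiv ℝ (g j) e (X e) * ai j (ψ e) (fderiv ℝ ψ e v) +
      ∑ i, ∑ j, f i e * g j e * fderiv ℝ (ai j) (ψ e) (Xi i (ψ e)) (fderiv ℝ ψ e v) +
      ∑ j, g j e * ai j (ψ e) (fderiv ℝ (fderiv ℝ ψ) e (X e) v) := by
    rw [fderiv_decomp_right hψ hai hg hdb, hdX.self_of_nhds, Finset.sum_comm (f := fun i j => _)]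
    simp [Finset.sum_add_distrib, Finset.mul_sum, mul_left_comm, mul_assoc]
  have A2 : b e (fderiv ℝ X e v) =
      ∑ i, ∑ j, fderiv ℝ (f i) e v * g j e * ai j (ψ e) (Xi i (ψ e)) +
      ∑ i, ∑ j, f i e * g j e * ai j (ψ e) (fderiv ℝ (Xi i) (ψ e) (fderiv ℝ ψ e v)) -
      ∑ j, g j e * ai j (ψ e) (fderiv ℝ (fderiv ℝ ψ) e (X e) v) := by
    have := fderiv_decomp_left hψ hX hXi hf hdX v
    rw [hdb.self_of_nhds, Finset.sum_comm, Finset.sum_comm (f := fun i j => f i e * _ * _)]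
    simp [this, Finset.sum_add_distrib, Finset.mul_sum, mul_comm, mul_left_comm, mul_assoc,
      mul_add, mul_sub, fderiv_fderiv_symm hψ v]
  have A3 : fderiv ℝ a e (Y e) v =
      ∑ i, fderiv ℝ (f i) e (Y e) * ai i (ψ e) (fderiv ℝ ψ e v) +
      ∑ i, ∑ j, f i e * g j e * fderiv ℝ (ai i) (ψ e) (Xi j (ψ e)) (fderiv ℝ ψ e v) +
      ∑ i, f i e * ai i (ψ e) (fderiv ℝ (fderiv ℝ ψ) e (Y e) v) := by
    rw [fderiv_decomp_right hψ hai hf hda, hdY.self_of_nhds]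
    simp [Finset.sum_add_distrib, Finset.mul_sum, mul_assoc]
  have A4 : fderiv ℝ a e v (Y e) =
      ∑ i, ∑ j, fderiv ℝ (f i) e v * g j e * ai i (ψ e) (Xi j (ψ e)) +
      ∑ i, ∑ j, f i e * g j e * fderiv ℝ (ai i) (ψ e) (fderiv ℝ ψ e v) (Xi j (ψ e)) +
      ∑ i, f i e * ai i (ψ e) (fderiv ℝ (fderiv ℝ ψ) e (Y e) v) := by
    rw [fderiv_decomp_right hψ hai hf hda, hdY.self_of_nhds]
    simp [Finset.sum_add_distrib, Finset.mul_sum, mul_comm, mul_left_comm, mul_assoc,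
      fderiv_fderiv_symm hψ v]
  -- Terms with a derivative of `f` along `v`; they cancel by isotropy.
  have A5 : ∑ i, ∑ j, fderiv ℝ (f i) e v * g j e * ai j (ψ e) (Xi i (ψ e)) +
      ∑ i, ∑ j, fderiv ℝ (f i) e v * g j e * ai i (ψ e) (Xi j (ψ e)) = 0 := by
    simp [← Finset.sum_add_distrib, ← mul_add, hiso]
  simp only [locCourant, add_apply, sub_apply, sum_apply, smul_apply, smul_eq_mul, A1, A2, A3, A4,
    ContinuousLinearMap.comp_apply, ContinuousLinearMap.flip_apply, mul_add, mul_sub,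
    Finset.sum_add_distrib, Finset.sum_sub_distrib]
  linarith

end Local

/-! ### Coordinate expressions of tensor fields -/

theorem contDiffAt_of_clm_apply {D E F : Type*} [NormedAddCommGroup D] [NormedSpace ℝ D]
    [NormedAddCommGroup E] [NormedSpace ℝ E] [NormedAddCommGroup F] [NormedSpace ℝ F]
    [FiniteDimensional ℝ E] {f : D → E →L[ℝ] F} {x : D}
    (h : ∀ y, ContDiffAt ℝ ∞ (fun z => f z y) x) : ContDiffAt ℝ ∞ f x := by
  let d := Module.finrank ℝ E
  have hd : d = Module.finrank ℝ (Fin d → ℝ) := (Module.finrank_fin_fun ℝ).symm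
  let e₁ := ContinuousLinearEquiv.ofFinrankEq hd
  let e₂ := (e₁.arrowCongr (1 : F ≃L[ℝ] F)).trans (ContinuousLinearEquiv.piRing (Fin d))
  rw [← Function.id_comp f, ← e₂.symm_comp_self]
  exact e₂.symm.contDiff.contDiffAt.comp x (contDiffAt_pi.mpr fun i => h _)

section Charts

variable {E : Type*} [NormedAddCommGroup E] [NormedSpace ℝ E]
  {M : Type*} [TopologicalSpace M] [ChartedSpace E M]

/-- The derivative at `z` of the preferred chart at `x`, with values in the model space. -/
def chartD (x z : M) : Tan E z →L[ℝ] E := mfderiv 𝓘(ℝ, E) 𝓘(ℝ, E) (extChartAt 𝓘(ℝ, E) x) z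

/-- The derivative at `e` of the inverse of the preferred chart at `x`. -/
def chartDSymm (x : M) (e : E) : E →L[ℝ] Tan E ((extChartAt 𝓘(ℝ, E) x).symm e) :=
  mfderiv 𝓘(ℝ, E) 𝓘(ℝ, E) (extChartAt 𝓘(ℝ, E) x).symm e

/-- The coordinate expression of the vector field `X` in the preferred chart at `x`. -/
def chartV (X : VField E M) (x : M) : E → E := fun e =>
  chartD x ((extChartAt 𝓘(ℝ, E) x).symm e) (X ((extChartAt 𝓘(ℝ, E) x).symm e))

/-- The coordinate expression of the `(1,1)`-tensor field `r` in the preferred chart at `x`. -/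
def chartT (r : Tensor11 E M) (x : M) : E → E →L[ℝ] E := fun e =>
  (chartD x ((extChartAt 𝓘(ℝ, E) x).symm e)).comp
    ((r ((extChartAt 𝓘(ℝ, E) x).symm e)).comp (chartDSymm x e))

theorem chartForm_apply (α : OneForm E M) (x : M) (e u : E) :
    chartForm α x e u = α ((extChartAt 𝓘(ℝ, E) x).symm e) (chartDSymm x e u) := rfl

/-- The contraction with the constant vector field `u` of the coordinate expression of `Ω` in the
preferred chart at `x`. -/
def chartBilin (Ω : BilinField E M) (x : M) (u e : E) : E →L[ℝ] ℝ :=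
  ContinuousLinearMap.comp (Ω ((extChartAt 𝓘(ℝ, E) x).symm e) (chartDSymm x e u)) (chartDSymm x e)

theorem contDiffAt_congr_iff {V : Type*} [NormedAddCommGroup V] [NormedSpace ℝ V] {f g : E → V}
    {e : E} (h : f =ᶠ[𝓝 e] g) : ContDiffAt ℝ ∞ f e ↔ ContDiffAt ℝ ∞ g e :=
  ⟨fun hf => hf.congr_of_eventuallyEq h.symm, fun hg => hg.congr_of_eventuallyEq h⟩

theorem eventually_mem_target (x : M) :
    ∀ᶠ e in 𝓝 (extChartAt 𝓘(ℝ, E) x x), e ∈ (extChartAt 𝓘(ℝ, E) x).target :=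
  extChartAt_target_mem_nhds x

theorem contMDiffAt_iff_contDiffAt_chart {V : Type*} [NormedAddCommGroup V] [NormedSpace ℝ V]
    (g : M → V) (x : M) :
    ContMDiffAt 𝓘(ℝ, E) 𝓘(ℝ, V) ∞ g x ↔
      ContDiffAt ℝ ∞ (fun e => g ((extChartAt 𝓘(ℝ, E) x).symm e)) (extChartAt 𝓘(ℝ, E) x x) := by
  rw [contMDiffAt_iff]
  simp only [extChartAt_model_space_eq_id, modelWithCornersSelf_coe, Set.range_id,
    contDiffWithinAt_univ]
  refine ⟨fun h => h.2, fun h => ⟨?_, h⟩⟩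
  have h1 : ContinuousAt (fun z => g ((extChartAt 𝓘(ℝ, E) x).symm (extChartAt 𝓘(ℝ, E) x z))) x :=
    ContinuousAt.comp (f := extChartAt 𝓘(ℝ, E) x) h.continuousAt (continuousAt_extChartAt x)
  refine h1.congr ?_
  filter_upwards [extChartAt_source_mem_nhds (I := 𝓘(ℝ, E)) x] with z hz
  rw [(extChartAt 𝓘(ℝ, E) x).left_inv hz]

variable [IsManifold 𝓘(ℝ, E) ∞ M]

theorem isManifold_one : IsManifold 𝓘(ℝ, E) 1 M := IsManifold.of_le (n := ∞) (by simp)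

theorem chartDSymm_chartD {x : M} {e : E} (he : e ∈ (extChartAt 𝓘(ℝ, E) x).target)
    (u : Tan E ((extChartAt 𝓘(ℝ, E) x).symm e)) :
    chartDSymm x e (chartD x ((extChartAt 𝓘(ℝ, E) x).symm e) u) = u := by
  have := isManifold_one (E := E) (M := M)
  have h := mfderivWithin_extChartAt_symm_comp_mfderiv_extChartAt (I := 𝓘(ℝ, E)) he
  rw [modelWithCornersSelf_coe, Set.range_id, mfderivWithin_univ] at h
  exact congrArg (fun T => T u) h

/-- The derivative at `x` of the preferred chart at `x` is the identity, because `TangentSpace`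
identifies `T_x M` with the model space through this chart. -/
theorem chartD_self (x : M) (u : Tan E x) : chartD x x u = u := by
  have := isManifold_one (E := E) (M := M)
  exact congrArg (fun T => T u) (mfderiv_extChartAt_self (I := 𝓘(ℝ, E)) (x := x))

theorem chartV_self (X : VField E M) (x : M) : chartV X x (extChartAt 𝓘(ℝ, E) x x) = X x := by
  have h := extChartAt_to_inv (I := 𝓘(ℝ, E)) x
  unfold chartV
  rw [h]
  exact chartD_self x (X x)

theorem chartDSymm_self (x : M) (u : E) :
    (chartDSymm x (extChartAt 𝓘(ℝ, E) x x) u : E) = u := by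
  have := isManifold_one (E := E) (M := M)
  have h := mfderivWithin_range_extChartAt_symm (I := 𝓘(ℝ, E)) (x := x)
  rw [modelWithCornersSelf_coe, Set.range_id, mfderivWithin_univ] at h
  exact congrArg (fun T => T u) h

theorem chartForm_self (α : OneForm E M) (x : M) (u : E) :
    chartForm α x (extChartAt 𝓘(ℝ, E) x x) u = α x u := by
  have h : ∀ z : M, z = x → α z (u : E) = α x u := by rintro _ rfl; rfl
  rw [chartForm_apply]
  have h2 := chartDSymm_self (E := E) x u
  exact (congrArg (α ((extChartAt 𝓘(ℝ, E) x).symm (extChartAt 𝓘(ℝ, E) x x))) h2).trans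
    (h _ (extChartAt_to_inv (I := 𝓘(ℝ, E)) x))

theorem chartT_self (r : Tensor11 E M) (x : M) (u : E) :
    chartT r x (extChartAt 𝓘(ℝ, E) x x) u = r x u := by
  have h : ∀ z : M, z = x → chartD x z (r z (u : E)) = r x u := by
    rintro _ rfl; exact chartD_self _ _
  have h2 := chartDSymm_self (E := E) x u
  exact (congrArg (fun w => chartD x _ (r ((extChartAt 𝓘(ℝ, E) x).symm
    (extChartAt 𝓘(ℝ, E) x x)) w)) h2).trans (h _ (extChartAt_to_inv (I := 𝓘(ℝ, E)) x))

theorem chartV_appV (r : Tensor11 E M) (X : VField E M) {x : M} {e : E}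
    (he : e ∈ (extChartAt 𝓘(ℝ, E) x).target) :
    chartV (appV r X) x e = chartT r x e (chartV X x e) := by
  simp only [chartV, chartT, appV, ContinuousLinearMap.comp_apply, chartDSymm_chartD he]

theorem chartForm_appF (r : Tensor11 E M) (α : OneForm E M) {x : M} {e : E}
    (he : e ∈ (extChartAt 𝓘(ℝ, E) x).target) :
    chartForm (appF r α) x e = (chartForm α x e).comp (chartT r x e) := by
  ext u
  simp only [chartForm_apply, chartT, appF, ContinuousLinearMap.comp_apply, chartDSymm_chartD he]

theorem chartForm_chartV (α : OneForm E M) (X : VField E M) {x : M} {e : E}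
    (he : e ∈ (extChartAt 𝓘(ℝ, E) x).target) :
    chartForm α x e (chartV X x e) = α ((extChartAt 𝓘(ℝ, E) x).symm e)
      (X ((extChartAt 𝓘(ℝ, E) x).symm e)) := by
  simp only [chartForm_apply, chartV, chartDSymm_chartD he]

/-! ### Smoothness in charts -/

theorem trivializationAt_continuousLinearMapAt {x : M} {e : E}
    (he : e ∈ (extChartAt 𝓘(ℝ, E) x).target) :
    (trivializationAt E (fun x : M => Tan E x) x).continuousLinearMapAt ℝ
      ((extChartAt 𝓘(ℝ, E) x).symm e) = chartD x ((extChartAt 𝓘(ℝ, E) x).symm e) := by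
  have := isManifold_one (E := E) (M := M)
  exact TangentBundle.continuousLinearMapAt_trivializationAt (I := 𝓘(ℝ, E)) (x₀ := x)
    (x := (extChartAt 𝓘(ℝ, E) x).symm e)
    (by rw [← extChartAt_source 𝓘(ℝ, E)]; exact (extChartAt _ x).map_target he)

theorem trivializationAt_symmL {x : M} {e : E}
    (he : e ∈ (extChartAt 𝓘(ℝ, E) x).target) :
    (trivializationAt E (fun x : M => Tan E x) x).symmL ℝ
      ((extChartAt 𝓘(ℝ, E) x).symm e) = chartDSymm x e := by
  have := isManifold_one (E := E) (M := M)
  have h := TangentBundle.symmL_trivializationAt (I := 𝓘(ℝ, E)) (x₀ := x)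
    (x := (extChartAt 𝓘(ℝ, E) x).symm e)
    (by rw [← extChartAt_source 𝓘(ℝ, E)]; exact (extChartAt _ x).map_target he)
  rw [modelWithCornersSelf_coe, Set.range_id, mfderivWithin_univ] at h
  refine h.trans ?_
  ext u
  have h2 : ∀ e' : E, e' = e → (mfderiv 𝓘(ℝ, E) 𝓘(ℝ, E) (extChartAt 𝓘(ℝ, E) x).symm e' u : E) =
    mfderiv 𝓘(ℝ, E) 𝓘(ℝ, E) (extChartAt 𝓘(ℝ, E) x).symm e u := by rintro _ rfl; rfl
  exact h2 _ ((extChartAt 𝓘(ℝ, E) x).right_inv he)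

theorem symm_mem_baseSet {x : M} {e : E} (he : e ∈ (extChartAt 𝓘(ℝ, E) x).target) :
    (extChartAt 𝓘(ℝ, E) x).symm e ∈ (trivializationAt E (fun x : M => Tan E x) x).baseSet := by
  rw [TangentBundle.trivializationAt_baseSet, ← extChartAt_source 𝓘(ℝ, E)]
  exact (extChartAt _ x).map_target he

theorem contMDiffAt_vField_iff (X : VField E M) (x : M) :
    ContMDiffAt 𝓘(ℝ, E) (𝓘(ℝ, E).prod 𝓘(ℝ, E)) ∞
      (fun x => Bundle.TotalSpace.mk' E (E := fun x : M => Tan E x) x (X x)) x ↔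
    ContDiffAt ℝ ∞ (chartV X x) (extChartAt 𝓘(ℝ, E) x x) := by
  rw [Bundle.contMDiffAt_section, contMDiffAt_iff_contDiffAt_chart]
  refine contDiffAt_congr_iff ?_
  filter_upwards [eventually_mem_target x] with e he
  rw [chartV, ← trivializationAt_continuousLinearMapAt he,
    Bundle.Trivialization.continuousLinearMapAt_apply_of_mem ℝ _ (symm_mem_baseSet he)]

theorem contMDiffAt_oneForm_iff (α : OneForm E M) (x : M) :
    ContMDiffAt 𝓘(ℝ, E) (𝓘(ℝ, E).prod 𝓘(ℝ, E →L[ℝ] ℝ)) ∞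
    (fun x => Bundle.TotalSpace.mk' (E →L[ℝ] ℝ) (E := fun x : M => Cot E x) x (α x)) x ↔
    ContDiffAt ℝ ∞ (chartForm α x) (extChartAt 𝓘(ℝ, E) x x) := by
  rw [contMDiffAt_hom_bundle]
  refine (and_iff_right contMDiffAt_id).trans ?_
  rw [contMDiffAt_iff_contDiffAt_chart]
  refine contDiffAt_congr_iff ?_
  filter_upwards [eventually_mem_target x] with e he
  ext u
  simp only [ContinuousLinearMap.inCoordinates, ContinuousLinearMap.comp_apply]
  rw [trivializationAt_symmL he]
  exact Bundle.Trivialization.continuousLinearMapAt_apply_of_mem ℝ _ (Set.mem_univ _) _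

theorem contMDiffAt_tensor_iff (r : Tensor11 E M) (x : M) :
    ContMDiffAt 𝓘(ℝ, E) (𝓘(ℝ, E).prod 𝓘(ℝ, E →L[ℝ] E)) ∞
    (fun x => Bundle.TotalSpace.mk' (E →L[ℝ] E)
      (E := fun x : M => Tan E x →L[ℝ] Tan E x) x (r x)) x ↔
    ContDiffAt ℝ ∞ (chartT r x) (extChartAt 𝓘(ℝ, E) x x) := by
  rw [contMDiffAt_hom_bundle]
  refine (and_iff_right contMDiffAt_id).trans ?_
  rw [contMDiffAt_iff_contDiffAt_chart]
  refine contDiffAt_congr_iff ?_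
  filter_upwards [eventually_mem_target x] with e he
  ext u
  simp only [ContinuousLinearMap.inCoordinates, ContinuousLinearMap.comp_apply]
  rw [trivializationAt_symmL he, trivializationAt_continuousLinearMapAt he]
  rfl

/-- A field of bilinear forms is smooth if, in charts, its contractions with constant vector
fields are smooth `1`-forms. -/
theorem contMDiffAt_bilin [FiniteDimensional ℝ E] (Ω : BilinField E M) (x : M)
    (h : ∀ u : E, ContDiffAt ℝ ∞ (chartBilin Ω x u) (extChartAt 𝓘(ℝ, E) x x)) :
    ContMDiffAt 𝓘(ℝ, E) (𝓘(ℝ, E).prod 𝓘(ℝ, E →L[ℝ] E →L[ℝ] ℝ)) ∞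
    (fun x => Bundle.TotalSpace.mk' (E →L[ℝ] E →L[ℝ] ℝ)
      (E := fun x : M => Tan E x →L[ℝ] Cot E x) x (Ω x)) x := by
  rw [contMDiffAt_hom_bundle]
  refine ⟨contMDiffAt_id, ?_⟩
  rw [contMDiffAt_iff_contDiffAt_chart]
  refine contDiffAt_of_clm_apply fun u => (h u).congr_of_eventuallyEq ?_
  filter_upwards [eventually_mem_target x] with e he
  ext v
  simp only [ContinuousLinearMap.inCoordinates, ContinuousLinearMap.comp_apply]
  rw [trivializationAt_symmL he, Bundle.Trivialization.continuousLinearMapAt_apply_of_mem ℝ _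
    ?_, hom_trivializationAt_apply]
  · simp only [ContinuousLinearMap.inCoordinates, ContinuousLinearMap.comp_apply]
    rw [trivializationAt_symmL he]
    exact Bundle.Trivialization.continuousLinearMapAt_apply_of_mem ℝ _ (Set.mem_univ _) _
  · rw [hom_trivializationAt_baseSet]
    exact ⟨symm_mem_baseSet he, trivial⟩

end Charts

/-! ### Cartan calculus in coordinates -/

section Formulas

variable {E : Type*} [NormedAddCommGroup E] [NormedSpace ℝ E]
  {M : Type*} [TopologicalSpace M] [ChartedSpace E M]

theorem dFun_apply {f : M → ℝ} (hf : ContMDiff 𝓘(ℝ, E) 𝓘(ℝ, ℝ) ∞ f) (x : M) (v : E) :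
    dFun (E := E) f x v =
      fderiv ℝ (fun e => f ((extChartAt 𝓘(ℝ, E) x).symm e)) (extChartAt 𝓘(ℝ, E) x x) v := by
  have h := ((hf x).mdifferentiableAt (by simp)).mfderiv
  rw [modelWithCornersSelf_coe, Set.range_id, fderivWithin_univ] at h
  exact congrArg (fun T => T v) h

variable [IsManifold 𝓘(ℝ, E) ∞ M]

theorem SmoothVField.chartV {X : VField E M} (hX : SmoothVField X) (x : M) :
    ContDiffAt ℝ ∞ (chartV X x) (extChartAt 𝓘(ℝ, E) x x) :=
  (contMDiffAt_vField_iff X x).1 (contMDiffOn_univ.1 hX x)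

theorem SmoothOneForm.chartForm {α : OneForm E M} (hα : SmoothOneForm α) (x : M) :
    ContDiffAt ℝ ∞ (chartForm α x) (extChartAt 𝓘(ℝ, E) x x) :=
  (contMDiffAt_oneForm_iff α x).1 (contMDiffOn_univ.1 hα x)

theorem SmoothTensor11.chartT {r : Tensor11 E M} (hr : SmoothTensor11 r) (x : M) :
    ContDiffAt ℝ ∞ (chartT r x) (extChartAt 𝓘(ℝ, E) x x) :=
  (contMDiffAt_tensor_iff r x).1 (hr x)

theorem smoothVField_of_chartV {X : VField E M}
    (h : ∀ x, ContDiffAt ℝ ∞ (chartV X x) (extChartAt 𝓘(ℝ, E) x x)) : SmoothVField X :=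
  contMDiffOn_univ.2 fun x => (contMDiffAt_vField_iff X x).2 (h x)

theorem smoothOneForm_of_chartForm {α : OneForm E M}
    (h : ∀ x, ContDiffAt ℝ ∞ (chartForm α x) (extChartAt 𝓘(ℝ, E) x x)) : SmoothOneForm α :=
  contMDiffOn_univ.2 fun x => (contMDiffAt_oneForm_iff α x).2 (h x)

theorem SmoothVField.appV {X : VField E M} {r : Tensor11 E M} (hr : SmoothTensor11 r)
    (hX : SmoothVField X) : SmoothVField (appV r X) := by
  refine smoothVField_of_chartV fun x => ?_
  refine ((hr.chartT x).clm_apply (hX.chartV x)).congr_of_eventuallyEq ?_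
  filter_upwards [eventually_mem_target x] with e he using chartV_appV r X he

theorem SmoothOneForm.appF {α : OneForm E M} {r : Tensor11 E M} (hr : SmoothTensor11 r)
    (hα : SmoothOneForm α) : SmoothOneForm (appF r α) := by
  refine smoothOneForm_of_chartForm fun x => ?_
  refine ((hα.chartForm x).clm_comp (hr.chartT x)).congr_of_eventuallyEq ?_
  filter_upwards [eventually_mem_target x] with e he using chartForm_appF r α he

theorem contMDiff_apply {α : OneForm E M} {X : VField E M} (hα : SmoothOneForm α)
    (hX : SmoothVField X) : ContMDiff 𝓘(ℝ, E) 𝓘(ℝ, ℝ) ∞ (fun x => α x (X x)) := by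
  intro x
  refine (contMDiffAt_iff_contDiffAt_chart _ _).2 ?_
  refine ((hα.chartForm x).clm_apply (hX.chartV x)).congr_of_eventuallyEq ?_
  filter_upwards [eventually_mem_target x] with e he using (chartForm_chartV α X he).symm

theorem mdifferentiableAt_chart_symm {x : M} {e : E} (he : e ∈ (extChartAt 𝓘(ℝ, E) x).target) :
    MDifferentiableAt 𝓘(ℝ, E) 𝓘(ℝ, E) (extChartAt 𝓘(ℝ, E) x).symm e := by
  have := isManifold_one (E := E) (M := M)
  have h := mdifferentiableWithinAt_extChartAt_symm (I := 𝓘(ℝ, E)) he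
  rwa [modelWithCornersSelf_coe, Set.range_id, mdifferentiableWithinAt_univ] at h

theorem chartForm_dFun {f : M → ℝ} (hf : ContMDiff 𝓘(ℝ, E) 𝓘(ℝ, ℝ) ∞ f) {x : M} {e : E}
    (he : e ∈ (extChartAt 𝓘(ℝ, E) x).target) :
    chartForm (dFun f) x e = fderiv ℝ (fun e => f ((extChartAt 𝓘(ℝ, E) x).symm e)) e := by
  have h := mfderiv_comp e ((hf _).mdifferentiableAt (by simp)) (mdifferentiableAt_chart_symm he)
  rw [mfderiv_eq_fderiv] at h
  exact h.symm

theorem SmoothOneForm.dFun {f : M → ℝ} (hf : ContMDiff 𝓘(ℝ, E) 𝓘(ℝ, ℝ) ∞ f) :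
    SmoothOneForm (dFun (E := E) f) := by
  refine smoothOneForm_of_chartForm fun x => ?_
  refine (((contMDiffAt_iff_contDiffAt_chart _ _).1 (hf x)).fderiv_right
    (m := ∞) (by simp)).congr_of_eventuallyEq ?_
  filter_upwards [eventually_mem_target x] with e he using chartForm_dFun hf he

/-- The Lie bracket at `x` is the Lie bracket of the coordinate expressions at `x`. -/
theorem bracket_eq (X Y : VField E M) (x : M) :
    bracket X Y x = (VectorField.lieBracket ℝ (chartV X x) (chartV Y x)
      (extChartAt 𝓘(ℝ, E) x x) : E) := by
  have := isManifold_one (E := E) (M := M)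
  have key : ∀ Z : VField E M, VectorField.mpullbackWithin 𝓘(ℝ, E) 𝓘(ℝ, E)
      (extChartAt 𝓘(ℝ, E) x).symm Z (Set.range 𝓘(ℝ, E)) =ᶠ[𝓝 (extChartAt 𝓘(ℝ, E) x x)]
      chartV Z x := by
    intro Z
    filter_upwards [eventually_mem_target x] with e he
    rw [VectorField.mpullbackWithin_apply]
    have h1 := mfderiv_extChartAt_comp_mfderivWithin_extChartAt_symm (I := 𝓘(ℝ, E)) he
    have h2 := mfderivWithin_extChartAt_symm_comp_mfderiv_extChartAt (I := 𝓘(ℝ, E)) he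
    rw [ContinuousLinearMap.inverse_eq h2 h1]
    rfl
  have hinv : (mfderiv 𝓘(ℝ, E) 𝓘(ℝ, E) (extChartAt 𝓘(ℝ, E) x) x).inverse =
      (ContinuousLinearMap.id ℝ E : E →L[ℝ] E) := by
    rw [mfderiv_extChartAt_self]
    exact ContinuousLinearMap.inverse_id
  rw [bracket, VectorField.mlieBracket, VectorField.mlieBracketWithin_apply]
  refine (congrArg (fun T : E →L[ℝ] E => T _) hinv).trans ?_
  simp only [ContinuousLinearMap.id_apply]
  simp only [Set.preimage_univ, Set.univ_inter]
  rw [modelWithCornersSelf_coe, Set.range_id]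
  rw [modelWithCornersSelf_coe, Set.range_id] at key
  refine (congrFun VectorField.lieBracketWithin_univ _).trans ?_
  exact (key X).lieBracket_vectorField_eq (key Y)

theorem iExtDeriv_apply (X : VField E M) (α : OneForm E M) (x : M) (v : E) :
    iExtDeriv X α x v =
      fderiv ℝ (chartForm α x) (extChartAt 𝓘(ℝ, E) x x)
        (chartV X x (extChartAt 𝓘(ℝ, E) x x)) v -
      fderiv ℝ (chartForm α x) (extChartAt 𝓘(ℝ, E) x x) v
        (chartV X x (extChartAt 𝓘(ℝ, E) x x)) :=
  congrArg₂ (fun a b : E => fderiv ℝ (chartForm α x) (extChartAt 𝓘(ℝ, E) x x) a b -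
    fderiv ℝ (chartForm α x) (extChartAt 𝓘(ℝ, E) x x) b a)
    ((chartD_self x (X x)).trans (chartV_self X x).symm) (chartD_self x v)

theorem dFun_pairing {α : OneForm E M} {X : VField E M} (hα : SmoothOneForm α)
    (hX : SmoothVField X) (x : M) (v : E) :
    dFun (E := E) (fun x => α x (X x)) x v =
      fderiv ℝ (chartForm α x) (extChartAt 𝓘(ℝ, E) x x) v
        (chartV X x (extChartAt 𝓘(ℝ, E) x x)) +
      chartForm α x (extChartAt 𝓘(ℝ, E) x x)
        (fderiv ℝ (chartV X x) (extChartAt 𝓘(ℝ, E) x x) v) := by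
  rw [dFun_apply (contMDiff_apply hα hX)]
  have h1 : (fun e => α ((extChartAt 𝓘(ℝ, E) x).symm e) (X ((extChartAt 𝓘(ℝ, E) x).symm e)))
      =ᶠ[𝓝 (extChartAt 𝓘(ℝ, E) x x)] fun e => chartForm α x e (chartV X x e) := by
    filter_upwards [eventually_mem_target x] with e he using (chartForm_chartV α X he).symm
  have h2 := (((hα.chartForm x).differentiableAt (by simp)).hasFDerivAt.clm_apply
    ((hX.chartV x).differentiableAt (by simp)).hasFDerivAt)
  rw [(h2.congr_of_eventuallyEq h1).fderiv]
  simp only [add_apply, ContinuousLinearMap.comp_apply, ContinuousLinearMap.flip_apply]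
  rw [add_comm]

/-- The invariant formula `(i_Y dα)(Z) = Y(α(Z)) - Z(α(Y)) - α([Y, Z])`. -/
theorem iExtDeriv_apply_eq {α : OneForm E M} {Y Z : VField E M} (hα : SmoothOneForm α)
    (hY : SmoothVField Y) (hZ : SmoothVField Z) (x : M) :
    iExtDeriv Y α x (Z x) = dFun (E := E) (fun x => α x (Z x)) x (Y x) -
      dFun (E := E) (fun x => α x (Y x)) x (Z x) - α x (bracket Y Z x) := by
  have h3 : α x (bracket Y Z x) = chartForm α x (extChartAt 𝓘(ℝ, E) x x)
      (VectorField.lieBracket ℝ (chartV Y x) (chartV Z x) (extChartAt 𝓘(ℝ, E) x x)) := by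
    rw [bracket_eq]
    exact (chartForm_self α x _).symm
  rw [h3]
  refine (iExtDeriv_apply Y α x (Z x)).trans ?_
  refine Eq.trans ?_ (congrArg₂ (fun a b : ℝ => a - b - _) (dFun_pairing hα hZ x (Y x))
    (dFun_pairing hα hY x (Z x))).symm
  rw [← chartV_self Y x, ← chartV_self Z x, VectorField.lieBracket, map_sub]
  ring

/-- The invariant formula `(ℒ_X β)(Z) = X(β(Z)) - β([X, Z])`. -/
theorem lieDer_apply_eq {β : OneForm E M} {X Z : VField E M} (hβ : SmoothOneForm β)
    (hX : SmoothVField X) (hZ : SmoothVField Z) (x : M) :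
    lieDer X β x (Z x) = dFun (E := E) (fun x => β x (Z x)) x (X x) - β x (bracket X Z x) := by
  have h := iExtDeriv_apply_eq hβ hX hZ x
  show iExtDeriv X β x (Z x) + dFun (E := E) (fun x => β x (X x)) x (Z x) = _
  rw [h]
  ring

theorem fderiv_chartV_appV {r : Tensor11 E M} {X : VField E M} (hr : SmoothTensor11 r)
    (hX : SmoothVField X) (x : M) (u : E) :
    fderiv ℝ (chartV (appV r X) x) (extChartAt 𝓘(ℝ, E) x x) u =
      fderiv ℝ (chartT r x) (extChartAt 𝓘(ℝ, E) x x) u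
        (chartV X x (extChartAt 𝓘(ℝ, E) x x)) +
      chartT r x (extChartAt 𝓘(ℝ, E) x x)
        (fderiv ℝ (chartV X x) (extChartAt 𝓘(ℝ, E) x x) u) := by
  have h2 : chartV (appV r X) x =ᶠ[𝓝 (extChartAt 𝓘(ℝ, E) x x)]
      fun e => chartT r x e (chartV X x e) := by
    filter_upwards [eventually_mem_target x] with e he using chartV_appV r X he
  have h3 := ((hr.chartT x).differentiableAt (by simp)).hasFDerivAt.clm_apply
    ((hX.chartV x).differentiableAt (by simp)).hasFDerivAt
  rw [(h3.congr_of_eventuallyEq h2).fderiv]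
  simp only [add_apply, ContinuousLinearMap.comp_apply, ContinuousLinearMap.flip_apply]
  rw [add_comm]

theorem apply_bracket_eq (r : Tensor11 E M) (X Y : VField E M) (x : M) :
    r x (bracket X Y x) = (chartT r x (extChartAt 𝓘(ℝ, E) x x)
      (VectorField.lieBracket ℝ (chartV X x) (chartV Y x) (extChartAt 𝓘(ℝ, E) x x)) : E) := by
  rw [chartT_self, bracket_eq]

/-- `D^r_X(Y)` at `x` depends on `X` only through its value at `x`. -/
theorem opD_eq {r : Tensor11 E M} {X : VField E M} (hr : SmoothTensor11 r)
    (hX : SmoothVField X) (Y : VField E M) (x : M) :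
    opD r X Y x = (locD (chartT r x) (chartV X x (extChartAt 𝓘(ℝ, E) x x)) (chartV Y x)
      (extChartAt 𝓘(ℝ, E) x x) : E) := by
  refine (congrArg₂ (fun a b : E => a - b) (bracket_eq Y (appV r X) x)
    (apply_bracket_eq r Y X x)).trans ?_
  simp only [VectorField.lieBracket, fderiv_chartV_appV hr hX, locD, map_sub,
    chartV_appV r X (mem_extChartAt_target x)]
  abel

/-- `D^{r,*}_X(α)` at `x` depends on `X` only through its value at `x`. -/
theorem opDStar_eq {r : Tensor11 E M} {α : OneForm E M} (hr : SmoothTensor11 r)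
    (hα : SmoothOneForm α) (X : VField E M) (x : M) :
    opDStar r X α x = (locDStar (chartT r x) (chartV X x (extChartAt 𝓘(ℝ, E) x x))
      (chartForm α x) (extChartAt 𝓘(ℝ, E) x x) : E →L[ℝ] ℝ) := by
  -- The exact terms `d(α(rX))` of the two Lie derivatives cancel.
  have h0 : opDStar r X α x = (iExtDeriv X (appF r α) x : E →L[ℝ] ℝ) -
      (iExtDeriv (appV r X) α x : E →L[ℝ] ℝ) :=
    add_sub_add_right_eq_sub (iExtDeriv X (appF r α) x : E →L[ℝ] ℝ)
      (iExtDeriv (appV r X) α x : E →L[ℝ] ℝ) (dFun (fun y => α y (r y (X y))) x : E →L[ℝ] ℝ)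
  rw [h0]
  have h2 : chartForm (appF r α) x =ᶠ[𝓝 (extChartAt 𝓘(ℝ, E) x x)]
      fun e => (chartForm α x e).comp (chartT r x e) := by
    filter_upwards [eventually_mem_target x] with e he using chartForm_appF r α he
  have h3 := ((hα.chartForm x).differentiableAt (by simp)).hasFDerivAt.clm_comp
      ((hr.chartT x).differentiableAt (by simp)).hasFDerivAt
  have h4 : ∀ u w : E, fderiv ℝ (chartForm (appF r α) x) (extChartAt 𝓘(ℝ, E) x x) u w =
      fderiv ℝ (chartForm α x) (extChartAt 𝓘(ℝ, E) x x) u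
        (chartT r x (extChartAt 𝓘(ℝ, E) x x) w) +
      chartForm α x (extChartAt 𝓘(ℝ, E) x x)
        (fderiv ℝ (chartT r x) (extChartAt 𝓘(ℝ, E) x x) u w) := by
    intro u w
    rw [(h3.congr_of_eventuallyEq h2).fderiv]
    simp [add_comm]
  refine ContinuousLinearMap.ext (M₁ := E) (M₂ := ℝ) fun v => ?_
  refine (congrArg₂ (fun a b : ℝ => a - b) (iExtDeriv_apply X (appF r α) x v)
    (iExtDeriv_apply (appV r X) α x v)).trans ?_
  refine Eq.trans ?_ (locDStar_apply _ _ _ _ v).symm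
  rw [h4, h4, chartV_appV r X (mem_extChartAt_target x)]
  ring

theorem courant_eq {X : VField E M} {β : OneForm E M} (hX : SmoothVField X)
    (hβ : SmoothOneForm β) (Y : VField E M) (α : OneForm E M) (x : M) :
    (lieDer X β - iExtDeriv Y α) x = (locCourant (chartV X x) (chartForm α x) (chartV Y x)
      (chartForm β x) (extChartAt 𝓘(ℝ, E) x x) : E →L[ℝ] ℝ) := by
  refine ContinuousLinearMap.ext (M₁ := E) (M₂ := ℝ) fun v => ?_
  refine (congrArg₂ (fun a b : ℝ => a - b) (congrArg₂ (fun a b : ℝ => a + b)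
    (iExtDeriv_apply X β x v) (dFun_pairing hβ hX x v)) (iExtDeriv_apply Y α x v)).trans ?_
  refine Eq.trans ?_ (locCourant_apply _ _ _ _ _ v).symm
  ring

/-- The torsion is tensorial: at `x` it depends on `X` and `Y` only through their values. -/
theorem torsion_eq {r : Tensor11 E M} {X Y : VField E M} (hr : SmoothTensor11 r)
    (hX : SmoothVField X) (hY : SmoothVField Y) (x : M) :
    bracket (appV r X) (appV r Y) x
      - r x (bracket (appV r X) Y x + bracket X (appV r Y) x - r x (bracket X Y x)) =
      (locTorsion (chartT r x) (chartV X x (extChartAt 𝓘(ℝ, E) x x))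
        (chartV Y x (extChartAt 𝓘(ℝ, E) x x)) (extChartAt 𝓘(ℝ, E) x x) : E) := by
  have h1 := congrArg₂ (fun a b : E => a - b) (congrArg₂ (fun a b : E => a + b)
    (bracket_eq (appV r X) Y x) (bracket_eq X (appV r Y) x)) (apply_bracket_eq r X Y x)
  refine (congrArg₂ (fun a b : E => a - b) (bracket_eq (appV r X) (appV r Y) x)
    ((chartT_self r x _).symm.trans
      (congrArg (chartT r x (extChartAt 𝓘(ℝ, E) x x)) h1))).trans ?_
  simp only [VectorField.lieBracket, fderiv_chartV_appV hr hX, fderiv_chartV_appV hr hY,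
    locTorsion, map_sub, map_add, chartV_appV r _ (mem_extChartAt_target x)]
  abel

theorem SmoothVField.bracket [CompleteSpace E] {X Y : VField E M} (hX : SmoothVField X)
    (hY : SmoothVField Y) : SmoothVField (bracket X Y) := by
  have : IsManifold 𝓘(ℝ, E) (((⊤ : ℕ∞) : WithTop ℕ∞) + 1) M := by simpa
  have : IsManifold 𝓘(ℝ, E) (minSmoothness ℝ 2) M :=
    IsManifold.of_le (n := ∞) (by simpa using ENat.LEInfty.out)
  refine contMDiffOn_univ.2 ?_
  exact ContDiff.mlieBracket_vectorField (m := ⊤) (n := ⊤) (contMDiffOn_univ.1 hX)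
    (contMDiffOn_univ.1 hY) (by simp)

/-! ### Continuity of the brackets

Pairing a bracket with a smooth section gives a continuous function, by the invariant formulas,
which express it through pairings and derivatives of pairings.
-/

section Continuity

theorem continuous_dFun {f : M → ℝ} {X : VField E M} (hf : ContMDiff 𝓘(ℝ, E) 𝓘(ℝ, ℝ) ∞ f)
    (hX : SmoothVField X) : Continuous fun x => dFun (E := E) f x (X x) :=
  (contMDiff_apply (SmoothOneForm.dFun hf) hX).continuous

variable [CompleteSpace E]

theorem continuous_lieDer {β : OneForm E M} {X Z : VField E M} (hβ : SmoothOneForm β)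
    (hX : SmoothVField X) (hZ : SmoothVField Z) : Continuous fun x => lieDer X β x (Z x) := by
  simp_rw [lieDer_apply_eq hβ hX hZ]
  exact (continuous_dFun (contMDiff_apply hβ hZ) hX).sub
    (contMDiff_apply hβ (hX.bracket hZ)).continuous

theorem continuous_iExtDeriv {α : OneForm E M} {Y Z : VField E M} (hα : SmoothOneForm α)
    (hY : SmoothVField Y) (hZ : SmoothVField Z) :
    Continuous fun x => iExtDeriv Y α x (Z x) := by
  simp_rw [iExtDeriv_apply_eq hα hY hZ]
  exact ((continuous_dFun (contMDiff_apply hα hZ) hY).sub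
    (continuous_dFun (contMDiff_apply hα hY) hZ)).sub
    (contMDiff_apply hα (hY.bracket hZ)).continuous

theorem continuous_pairing_courant {X Y Z : VField E M} {α β γ : OneForm E M}
    (hX : SmoothVField X) (hY : SmoothVField Y) (hZ : SmoothVField Z) (hα : SmoothOneForm α)
    (hβ : SmoothOneForm β) (hγ : SmoothOneForm γ) :
    Continuous fun x => pairing (E := E)
      ((DiracGeom.bracket X Y x, (lieDer X β - iExtDeriv Y α) x) : GTan E x) (Z x, γ x) :=
  (contMDiff_apply hγ (hX.bracket hY)).continuous.add
    ((continuous_lieDer hβ hX hZ).sub (continuous_iExtDeriv hα hY hZ))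

theorem continuous_pairing_opD {X Y Z : VField E M} {α γ : OneForm E M} {r : Tensor11 E M}
    (hr : SmoothTensor11 r) (hX : SmoothVField X) (hY : SmoothVField Y) (hZ : SmoothVField Z)
    (hα : SmoothOneForm α) (hγ : SmoothOneForm γ) :
    Continuous fun x => pairing (E := E) ((opD r X Y x, opDStar r X α x) : GTan E x)
      (Z x, γ x) := by
  have h1 : ∀ x, γ x (opD r X Y x) = γ x (DiracGeom.bracket Y (DiracGeom.appV r X) x) -
      DiracGeom.appF r γ x (DiracGeom.bracket Y X x) := fun x => map_sub (γ x) _ _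
  have h2 : Continuous fun x => γ x (opD r X Y x) := by
    simp_rw [h1]
    exact (contMDiff_apply hγ (hY.bracket (hX.appV hr))).continuous.sub
      (contMDiff_apply (hγ.appF hr) (hY.bracket hX)).continuous
  exact h2.add ((continuous_lieDer (hα.appF hr) hX hZ).sub
    (continuous_lieDer hα (hX.appV hr) hZ))

end Continuity

end Formulas

/-! ### Global sections -/

section Bump

variable {E : Type*} [NormedAddCommGroup E] [NormedSpace ℝ E] [FiniteDimensional ℝ E]
  {M : Type*} [TopologicalSpace M] [T2Space M] [ChartedSpace E M] [IsManifold 𝓘(ℝ, E) ∞ M]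

/-- Near each point, a smooth subbundle is spanned by finitely many global sections. -/
theorem IsSubbundle.exists_sections_span {L : SubFamily E M} (hL : IsSubbundle L) (x₀ : M) :
    ∃ (k : ℕ) (X : Fin k → VField E M) (α : Fin k → OneForm E M),
      (∀ i, IsSection L (X i) (α i)) ∧
      ∀ᶠ x in 𝓝 x₀, Submodule.span ℝ (Set.range fun i => ((X i x, α i x) : GTan E x)) = L x := by
  obtain ⟨U, hU, hx₀, k, X, α, hX, hα, h⟩ := hL x₀
  obtain ⟨ρ, hρ, -⟩ := (SmoothBumpFunction.nhds_basis_support (I := 𝓘(ℝ, E))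
    (hU.mem_nhds hx₀)).mem_iff.1 (hU.mem_nhds hx₀)
  have hρs : ContMDiffOn 𝓘(ℝ, E) 𝓘(ℝ, ℝ) ∞ ρ U := ρ.contMDiff.contMDiffOn
  refine ⟨k, fun i => (ρ : M → ℝ) • X i, fun i => (ρ : M → ℝ) • α i, fun i => ⟨?_, ?_, ?_⟩, ?_⟩
  · exact contMDiffOn_univ.2 (ContMDiffOn.smul_section_of_tsupport hρs hU hρ (hX i))
  · exact contMDiffOn_univ.2 (ContMDiffOn.smul_section_of_tsupport hρs hU hρ (hα i))
  · intro x
    by_cases hx : x ∈ U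
    · have h1 : ((X i x, α i x) : GTan E x) ∈ L x := by
        rw [← (h x hx).2]
        exact Submodule.subset_span ⟨i, rfl⟩
      exact (L x).smul_mem (ρ x) h1
    · have h0 : ρ x = 0 := image_eq_zero_of_notMem_tsupport fun h' => hx (hρ h')
      have h1 : (((ρ : M → ℝ) • X i) x, ((ρ : M → ℝ) • α i) x) = (0 : GTan E x) := by
        simp only [Pi.smul_apply', h0, zero_smul]
        rfl
      rw [h1]
      exact (L x).zero_mem
  · filter_upwards [hU.mem_nhds hx₀, ρ.eventuallyEq_one] with x hx hx1
    rw [← (h x hx).2]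
    simp only [Pi.smul_apply', hx1, Pi.one_apply, one_smul]

theorem exists_smoothVField_eq (x : M) (v : Tan E x) :
    ∃ X : VField E M, SmoothVField X ∧ X x = v := by
  obtain ⟨s, hs, h⟩ := FiberBundle.exists_contMDiffOn_extend (k := ∞) 𝓘(ℝ, E) E
    (V := fun x : M => Tan E x) v
  obtain ⟨U, hUs, hU, hx⟩ := mem_nhds_iff.1 hs
  obtain ⟨ρ, hρ, -⟩ := (SmoothBumpFunction.nhds_basis_support (I := 𝓘(ℝ, E))
    (hU.mem_nhds hx)).mem_iff.1 (hU.mem_nhds hx)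
  refine ⟨(ρ : M → ℝ) • FiberBundle.extend E v, contMDiffOn_univ.2
    (ContMDiffOn.smul_section_of_tsupport ρ.contMDiff.contMDiffOn hU hρ (h.mono hUs)), ?_⟩
  simp

/-- If the pairings of `p` with the sections of a lagrangian subbundle `L` are continuous and `p`
takes values in `L` on a dense set, then it does so everywhere. -/
theorem IsLagrangian.mem_of_dense {L : SubFamily E M} (hL : IsLagrangian L)
    (p : ∀ x : M, GTan E x)
    (hp : ∀ Z γ, IsSection L Z γ → Continuous fun x => pairing (p x) (Z x, γ x))
    {D : Set M} (hD : Dense D) (h : ∀ y ∈ D, p y ∈ L y) (x : M) : p x ∈ L x := by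
  rw [hL.mem_iff]
  obtain ⟨k, Z, γ, hZ, hspan⟩ := hL.subbundle.exists_sections_span x
  have h0 : ∀ i, pairing (p x) (Z i x, γ i x) = 0 := fun i =>
    congrFun (Continuous.ext_on hD (hp _ _ (hZ i)) continuous_const fun y hy =>
      (hL.mem_iff y (p y)).1 (h y hy) _ ((hZ i).mem y)) x
  intro q hq
  rw [← hspan.self_of_nhds] at hq
  induction hq using Submodule.span_induction with
  | mem q hq => obtain ⟨i, rfl⟩ := hq; exact h0 i
  | zero => simp [pairing]
  | add a b _ _ ha hb =>
    have : pairing (p x) (a + b) = pairing (p x) a + pairing (p x) b := by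
      simp only [pairing, Prod.fst_add, Prod.snd_add, map_add, add_apply]
      exact add_add_add_comm (G := ℝ) _ _ _ _
    rw [this, ha, hb, add_zero]
  | smul c a _ ha =>
    have : pairing (p x) (c • a) = c * pairing (p x) a := by
      simp only [pairing, Prod.smul_fst, Prod.smul_snd, map_smul, smul_apply]
      exact (mul_add c _ _).symm
    rw [this, ha, mul_zero]

end Bump

/-! ### Maps in charts -/

section Maps

variable {E : Type*} [NormedAddCommGroup E] [NormedSpace ℝ E]
  {F : Type*} [NormedAddCommGroup F] [NormedSpace ℝ F]
  {N : Type*} [TopologicalSpace N] [ChartedSpace E N]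
  {M : Type*} [TopologicalSpace M] [ChartedSpace F M]

/-- The coordinate expression of `ψ` in the preferred charts at `x` and `ψ x`. -/
def chartMap (E F : Type*) [NormedAddCommGroup E] [NormedSpace ℝ E] [NormedAddCommGroup F]
    [NormedSpace ℝ F] {N : Type*} [TopologicalSpace N] [ChartedSpace E N] {M : Type*}
    [TopologicalSpace M] [ChartedSpace F M] (ψ : N → M) (x : N) : E → F := fun e =>
  extChartAt 𝓘(ℝ, F) (ψ x) (ψ ((extChartAt 𝓘(ℝ, E) x).symm e))

theorem chartMap_self (ψ : N → M) (x : N) :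
    chartMap E F ψ x (extChartAt 𝓘(ℝ, E) x x) = extChartAt 𝓘(ℝ, F) (ψ x) (ψ x) := by
  rw [chartMap, extChartAt_to_inv]

theorem eventually_mem_source {ψ : N → M} (hψ : ContMDiff 𝓘(ℝ, E) 𝓘(ℝ, F) ∞ ψ) (x : N) :
    ∀ᶠ e in 𝓝 (extChartAt 𝓘(ℝ, E) x x),
      ψ ((extChartAt 𝓘(ℝ, E) x).symm e) ∈ (extChartAt 𝓘(ℝ, F) (ψ x)).source := by
  have h : ContinuousAt (fun e => ψ ((extChartAt 𝓘(ℝ, E) x).symm e))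
      (extChartAt 𝓘(ℝ, E) x x) := by
    refine ContinuousAt.comp ?_ (continuousAt_extChartAt_symm x)
    exact hψ.continuous.continuousAt
  refine h.eventually_mem ?_
  rw [extChartAt_to_inv]
  exact extChartAt_source_mem_nhds _

theorem chartMap_contDiffAt {ψ : N → M} (hψ : ContMDiff 𝓘(ℝ, E) 𝓘(ℝ, F) ∞ ψ) (x : N) :
    ContDiffAt ℝ ∞ (chartMap E F ψ x) (extChartAt 𝓘(ℝ, E) x x) := by
  have h := (contMDiffAt_iff.1 (hψ x)).2
  rwa [modelWithCornersSelf_coe, Set.range_id, contDiffWithinAt_univ] at h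

/-- In the preferred charts at `x` and `ψ x`, the tangent map at `x` is the derivative of the
coordinate expression. -/
theorem tmap_eq {ψ : N → M} (hψ : ContMDiff 𝓘(ℝ, E) 𝓘(ℝ, F) ∞ ψ) (x : N) (v : E) :
    tmap E F ψ x v = fderiv ℝ (chartMap E F ψ x) (extChartAt 𝓘(ℝ, E) x x) v := by
  have h := ((hψ x).mdifferentiableAt (by simp)).mfderiv
  rw [modelWithCornersSelf_coe, Set.range_id, fderivWithin_univ] at h
  exact congrArg (fun T => T v) h

theorem chartV_extChartAt (X : VField F M) {y w : M}
    (hw : w ∈ (extChartAt 𝓘(ℝ, F) y).source) :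
    chartV X y (extChartAt 𝓘(ℝ, F) y w) = chartD y w (X w) := by
  rw [chartV, (extChartAt 𝓘(ℝ, F) y).left_inv hw]

variable [IsManifold 𝓘(ℝ, E) ∞ N] [IsManifold 𝓘(ℝ, F) ∞ M]

theorem fderiv_chartMap {ψ : N → M} (hψ : ContMDiff 𝓘(ℝ, E) 𝓘(ℝ, F) ∞ ψ) {x : N} {e : E}
    (he : e ∈ (extChartAt 𝓘(ℝ, E) x).target)
    (he' : ψ ((extChartAt 𝓘(ℝ, E) x).symm e) ∈ (extChartAt 𝓘(ℝ, F) (ψ x)).source) (u : E) :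
    fderiv ℝ (chartMap E F ψ x) e u = chartD (ψ x) (ψ ((extChartAt 𝓘(ℝ, E) x).symm e))
      (tmap E F ψ ((extChartAt 𝓘(ℝ, E) x).symm e) (chartDSymm x e u)) := by
  have := isManifold_one (E := F) (M := M)
  have h1 := mdifferentiableAt_chart_symm he
  have h2 := (hψ ((extChartAt 𝓘(ℝ, E) x).symm e)).mdifferentiableAt (by simp)
  have h3 : MDifferentiableAt 𝓘(ℝ, F) 𝓘(ℝ, F) (extChartAt 𝓘(ℝ, F) (ψ x))
      (ψ ((extChartAt 𝓘(ℝ, E) x).symm e)) :=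
    mdifferentiableAt_extChartAt (by rwa [← extChartAt_source 𝓘(ℝ, F)])
  have h4 := mfderiv_comp e (h3.comp _ h2) h1
  rw [mfderiv_comp _ h3 h2, mfderiv_eq_fderiv] at h4
  exact congrArg (fun T => T u) h4

theorem chartForm_extChartAt (β : OneForm F M) {y w : M}
    (hw : w ∈ (extChartAt 𝓘(ℝ, F) y).source) (v : Tan F w) :
    chartForm β y (extChartAt 𝓘(ℝ, F) y w) (chartD y w v) = β w v := by
  obtain ⟨e, he, rfl⟩ : ∃ e ∈ (extChartAt 𝓘(ℝ, F) y).target,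
      (extChartAt 𝓘(ℝ, F) y).symm e = w :=
    ⟨_, (extChartAt 𝓘(ℝ, F) y).map_source hw, (extChartAt 𝓘(ℝ, F) y).left_inv hw⟩
  rw [(extChartAt 𝓘(ℝ, F) y).right_inv he, chartForm_apply, chartDSymm_chartD he]

theorem chartT_extChartAt (r : Tensor11 F M) {y w : M}
    (hw : w ∈ (extChartAt 𝓘(ℝ, F) y).source) (v : Tan F w) :
    chartT r y (extChartAt 𝓘(ℝ, F) y w) (chartD y w v) = chartD y w (r w v) := by
  obtain ⟨e, he, rfl⟩ : ∃ e ∈ (extChartAt 𝓘(ℝ, F) y).target,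
      (extChartAt 𝓘(ℝ, F) y).symm e = w :=
    ⟨_, (extChartAt 𝓘(ℝ, F) y).map_source hw, (extChartAt 𝓘(ℝ, F) y).left_inv hw⟩
  rw [(extChartAt 𝓘(ℝ, F) y).right_inv he, chartT]
  simp only [ContinuousLinearMap.comp_apply, chartDSymm_chartD he]

theorem chartD_injective {y w : M} (hw : w ∈ (extChartAt 𝓘(ℝ, F) y).source) :
    Function.Injective (chartD (E := F) y w) := by
  obtain ⟨e, he, rfl⟩ : ∃ e ∈ (extChartAt 𝓘(ℝ, F) y).target,
      (extChartAt 𝓘(ℝ, F) y).symm e = w :=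
    ⟨_, (extChartAt 𝓘(ℝ, F) y).map_source hw, (extChartAt 𝓘(ℝ, F) y).left_inv hw⟩
  exact Function.LeftInverse.injective (chartDSymm_chartD he)

/-- Related tensors have related coordinate expressions. -/
theorem AreRelated.eventually_chart {ψ : N → M} (hψ : ContMDiff 𝓘(ℝ, E) 𝓘(ℝ, F) ∞ ψ)
    {rN : Tensor11 E N} {rM : Tensor11 F M} (h : AreRelated ψ rN rM) (x : N) :
    ∀ᶠ e in 𝓝 (extChartAt 𝓘(ℝ, E) x x),
      (chartT rM (ψ x) (chartMap E F ψ x e)).comp (fderiv ℝ (chartMap E F ψ x) e) =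
        (fderiv ℝ (chartMap E F ψ x) e).comp (chartT rN x e) := by
  filter_upwards [eventually_mem_target x, eventually_mem_source hψ x] with e he he'
  ext u
  rw [ContinuousLinearMap.comp_apply, ContinuousLinearMap.comp_apply, fderiv_chartMap hψ he he',
    fderiv_chartMap hψ he he', chartMap, chartT_extChartAt rM he', h, chartT]
  simp only [ContinuousLinearMap.comp_apply, chartDSymm_chartD he]

theorem fderiv_chartMap_chartV {ψ : N → M} (hψ : ContMDiff 𝓘(ℝ, E) 𝓘(ℝ, F) ∞ ψ) {x : N} {e : E}
    (he : e ∈ (extChartAt 𝓘(ℝ, E) x).target)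
    (he' : ψ ((extChartAt 𝓘(ℝ, E) x).symm e) ∈ (extChartAt 𝓘(ℝ, F) (ψ x)).source)
    (X : VField E N) :
    fderiv ℝ (chartMap E F ψ x) e (chartV X x e) =
      chartD (ψ x) (ψ ((extChartAt 𝓘(ℝ, E) x).symm e))
      (tmap E F ψ ((extChartAt 𝓘(ℝ, E) x).symm e) (X ((extChartAt 𝓘(ℝ, E) x).symm e))) := by
  rw [fderiv_chartMap hψ he he', chartV, chartDSymm_chartD he]

theorem chartForm_chartMap {ψ : N → M} (hψ : ContMDiff 𝓘(ℝ, E) 𝓘(ℝ, F) ∞ ψ) {x : N} {e : E}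
    (he : e ∈ (extChartAt 𝓘(ℝ, E) x).target)
    (he' : ψ ((extChartAt 𝓘(ℝ, E) x).symm e) ∈ (extChartAt 𝓘(ℝ, F) (ψ x)).source)
    (β : OneForm F M) (u : E) :
    chartForm β (ψ x) (chartMap E F ψ x e) (fderiv ℝ (chartMap E F ψ x) e u) =
      β (ψ ((extChartAt 𝓘(ℝ, E) x).symm e))
        (tmap E F ψ ((extChartAt 𝓘(ℝ, E) x).symm e) (chartDSymm x e u)) := by
  rw [fderiv_chartMap hψ he he', chartMap, chartForm_extChartAt β he']

end Maps

/-! ### Regular points of a backward image -/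

section Regular

variable {E : Type*} [NormedAddCommGroup E] [NormedSpace ℝ E]
  {F : Type*} [NormedAddCommGroup F] [NormedSpace ℝ F]
  {N : Type*} [TopologicalSpace N] [ChartedSpace E N] [IsManifold 𝓘(ℝ, E) ∞ N]
  {M : Type*} [TopologicalSpace M] [ChartedSpace F M] [IsManifold 𝓘(ℝ, F) ∞ M]

/-- A point `y` is regular for the backward image of `L` along `ψ` if there is a finite family of
global sections `(Xᵢ, αᵢ)` of `L` such that near `y` every section `(X, α)` of the backward image
satisfies `dψ(X) = ∑ fᵢ (Xᵢ ∘ ψ)` and `α = ∑ fᵢ ψ^*αᵢ` with smooth coefficients `fᵢ`. The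
relations are written in the preferred charts at `y` and `ψ y`. -/
def IsRegularPoint (ψ : N → M) (L : SubFamily F M) (y : N) : Prop :=
  ∃ (k : ℕ) (Xi : Fin k → VField F M) (αi : Fin k → OneForm F M),
    (∀ i, IsSection L (Xi i) (αi i)) ∧
    ∀ (X : VField E N) (α : OneForm E N), IsSection (backward ψ L) X α →
      ∃ f : Fin k → E → ℝ, (∀ i, ContDiffAt ℝ ∞ (f i) (extChartAt 𝓘(ℝ, E) y y)) ∧
        (∀ᶠ e in 𝓝 (extChartAt 𝓘(ℝ, E) y y),
          fderiv ℝ (chartMap E F ψ y) e (chartV X y e) =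
            ∑ i, f i e • chartV (Xi i) (ψ y) (chartMap E F ψ y e)) ∧
        (∀ᶠ e in 𝓝 (extChartAt 𝓘(ℝ, E) y y),
          chartForm α y e = ∑ i, f i e •
            (chartForm (αi i) (ψ y) (chartMap E F ψ y e)).comp
              (fderiv ℝ (chartMap E F ψ y) e))

/-- The coordinate isomorphism `T_{ψ z} M ⊕ T*_z N → F ⊕ E*` at `z = φ⁻¹(e)`. -/
def pairChart (ψ : N → M) (y : N) (e : E) :
    Tan F (ψ ((extChartAt 𝓘(ℝ, E) y).symm e)) × Cot E ((extChartAt 𝓘(ℝ, E) y).symm e) →ₗ[ℝ]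
      F × (E →L[ℝ] ℝ) where
  toFun p := (chartD (ψ y) _ p.1, ContinuousLinearMap.comp p.2 (chartDSymm y e))
  map_add' p q := Prod.ext (map_add (chartD (ψ y) _) p.1 q.1)
    (ContinuousLinearMap.add_comp p.2 q.2 (chartDSymm y e))
  map_smul' c p := Prod.ext (map_smul (chartD (ψ y) _) c p.1)
    (ContinuousLinearMap.smul_comp c p.2 (chartDSymm y e))

theorem pairChart_injective {ψ : N → M} {y : N} {e : E}
    (he : e ∈ (extChartAt 𝓘(ℝ, E) y).target)
    (he' : ψ ((extChartAt 𝓘(ℝ, E) y).symm e) ∈ (extChartAt 𝓘(ℝ, F) (ψ y)).source) :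
    Function.Injective (pairChart (F := F) ψ y e) := by
  intro p q h
  refine Prod.ext (chartD_injective he' (congrArg Prod.fst h)) ?_
  ext u
  have h2 := congrArg (fun T => T.2 (chartD y _ u)) h
  have h3 : p.2 (chartDSymm y e (chartD y _ u)) = q.2 (chartDSymm y e (chartD y _ u)) := h2
  rwa [chartDSymm_chartD he] at h3

/-- The linear map `(u, β) ↦ (u, (T_z ψ)^* β)`. -/
def pullPair (E F : Type*) [NormedAddCommGroup E] [NormedSpace ℝ E] [NormedAddCommGroup F]
    [NormedSpace ℝ F] {N : Type*} [TopologicalSpace N] [ChartedSpace E N] {M : Type*}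
    [TopologicalSpace M] [ChartedSpace F M] (ψ : N → M) (z : N) :
    GTan F (ψ z) →ₗ[ℝ] Tan F (ψ z) × Cot E z where
  toFun p := (p.1, ContinuousLinearMap.comp p.2 (tmap E F ψ z))
  map_add' p q := Prod.ext rfl (ContinuousLinearMap.add_comp p.2 q.2 (tmap E F ψ z))
  map_smul' c p := Prod.ext rfl (ContinuousLinearMap.smul_comp c p.2 (tmap E F ψ z))

variable [FiniteDimensional ℝ E] [FiniteDimensional ℝ F] [T2Space M]

/-- Regular points are dense: at points where the rank of the pulled back family is locally
maximal, a section of the backward image is a smooth combination of the family. -/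
theorem dense_isRegularPoint {ψ : N → M} (hψ : ContMDiff 𝓘(ℝ, E) 𝓘(ℝ, F) ∞ ψ)
    {L : SubFamily F M} (hL : IsSubbundle L) :
    Dense {y : N | IsRegularPoint (E := E) ψ L y} := by
  rw [dense_iff_inter_open]
  rintro W hW ⟨x₀, hx₀⟩
  obtain ⟨k, Xi, αi, hsec, hspan⟩ := hL.exists_sections_span (ψ x₀)
  -- The rank of `(Xᵢ ∘ ψ, ψ^*αᵢ)` is bounded by `k`, so it has a maximum on the open set.
  obtain ⟨V, hV, hVo, hψx₀⟩ := eventually_nhds_iff.1 hspan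
  let v : ∀ z : N, Fin k → Tan F (ψ z) × Cot E z := fun z i =>
    pullPair E F ψ z (Xi i (ψ z), αi i (ψ z))
  let rk : N → ℕ := fun z => Module.finrank ℝ (Submodule.span ℝ (Set.range (v z)))
  have hW' : IsOpen (W ∩ ψ ⁻¹' V) := hW.inter (hVo.preimage hψ.continuous)
  obtain ⟨y, ⟨hyW, hyV⟩, hmax⟩ : ∃ y ∈ W ∩ ψ ⁻¹' V, ∀ z ∈ W ∩ ψ ⁻¹' V, rk z ≤ rk y := by
    have hne : (rk '' (W ∩ ψ ⁻¹' V)).Nonempty := ⟨_, x₀, ⟨hx₀, hψx₀⟩, rfl⟩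
    have hbd : BddAbove (rk '' (W ∩ ψ ⁻¹' V)) := by
      refine ⟨k, ?_⟩
      rintro _ ⟨z, -, rfl⟩
      exact (finrank_range_le_card (R := ℝ) (v z)).trans (by simp)
    obtain ⟨y, hy, hy'⟩ := Nat.sSup_mem hne hbd
    exact ⟨y, hy, fun z hz => hy' ▸ le_csSup hbd ⟨z, hz, rfl⟩⟩
  refine ⟨y, hyW, k, Xi, αi, hsec, fun X α hXα => ?_⟩
  set p := extChartAt 𝓘(ℝ, E) y y with hp
  let w : Fin k → E → F × (E →L[ℝ] ℝ) := fun i e =>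
    (chartV (Xi i) (ψ y) (chartMap E F ψ y e),
      (chartForm (αi i) (ψ y) (chartMap E F ψ y e)).comp (fderiv ℝ (chartMap E F ψ y) e))
  let b : E → F × (E →L[ℝ] ℝ) := fun e =>
    (fderiv ℝ (chartMap E F ψ y) e (chartV X y e), chartForm α y e)
  have hψs := chartMap_contDiffAt hψ y
  have hψd : ContDiffAt ℝ ∞ (fderiv ℝ (chartMap E F ψ y)) p :=
    hψs.fderiv_right (m := ∞) (by simp)
  have hw : ∀ i, ContDiffAt ℝ ∞ (w i) p := fun i => by
    have h1 := (hsec i).smooth_left.chartV (ψ y)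
    have h2 := (hsec i).smooth_right.chartForm (ψ y)
    rw [← chartMap_self (E := E)] at h1 h2
    exact (h1.comp p hψs).prodMk ((h2.comp p hψs).clm_comp hψd)
  have hb : ContDiffAt ℝ ∞ b p :=
    (hψd.clm_apply (hXα.smooth_left.chartV y)).prodMk (hXα.smooth_right.chartForm y)
  have hwT : ∀ᶠ e in 𝓝 p, Function.Injective (pairChart (F := F) ψ y e) ∧
      (∀ i, w i e = pairChart ψ y e (v ((extChartAt 𝓘(ℝ, E) y).symm e) i)) ∧
      b e = pairChart ψ y e (tmap E F ψ _ (X ((extChartAt 𝓘(ℝ, E) y).symm e)),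
        α ((extChartAt 𝓘(ℝ, E) y).symm e)) := by
    filter_upwards [eventually_mem_target y, eventually_mem_source hψ y] with e he he'
    refine ⟨pairChart_injective he he', fun i => ?_, ?_⟩
    · refine Prod.ext (chartV_extChartAt (Xi i) he') ?_
      ext u
      exact chartForm_chartMap hψ he he' (αi i) u
    · exact Prod.ext (fderiv_chartMap_chartV hψ he he' X) rfl
  have hspanw : ∀ᶠ e in 𝓝 p, Submodule.span ℝ (Set.range fun i => w i e) =
      (Submodule.span ℝ (Set.range (v ((extChartAt 𝓘(ℝ, E) y).symm e)))).map
        (pairChart ψ y e) := by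
    filter_upwards [hwT] with e he
    rw [Submodule.map_span, ← Set.range_comp]
    congr 2
    exact funext he.2.1
  have hrkw : ∀ᶠ e in 𝓝 p, Module.finrank ℝ (Submodule.span ℝ (Set.range fun i => w i e)) =
      rk ((extChartAt 𝓘(ℝ, E) y).symm e) := by
    filter_upwards [hwT, hspanw] with e he he2
    rw [he2]
    exact (Submodule.equivMapOfInjective _ he.1 _).finrank_eq.symm
  have hcont : ∀ᶠ e in 𝓝 p, (extChartAt 𝓘(ℝ, E) y).symm e ∈ W ∩ ψ ⁻¹' V := by
    refine (continuousAt_extChartAt_symm (I := 𝓘(ℝ, E)) y).eventually_mem ?_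
    rw [extChartAt_to_inv]
    exact hW'.mem_nhds ⟨hyW, hyV⟩
  have hrank : ∀ᶠ e in 𝓝 p, Module.finrank ℝ (Submodule.span ℝ (Set.range fun i => w i e)) ≤
      Module.finrank ℝ (Submodule.span ℝ (Set.range fun i => w i p)) := by
    have h0 := hrkw.self_of_nhds
    rw [hp, extChartAt_to_inv, ← hp] at h0
    filter_upwards [hrkw, hcont] with e he he2
    rw [he, h0]
    exact hmax _ he2
  have hmem : ∀ᶠ e in 𝓝 p, b e ∈ Submodule.span ℝ (Set.range fun i => w i e) := by
    filter_upwards [hwT, hspanw, hcont] with e he he2 he3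
    rw [he2, he.2.2]
    refine Submodule.mem_map_of_mem ?_
    obtain ⟨β, hβ, hαβ⟩ := hXα.mem ((extChartAt 𝓘(ℝ, E) y).symm e)
    rw [← hV _ he3.2] at hβ
    obtain ⟨c, hc⟩ := (Submodule.mem_span_range_iff_exists_fun ℝ).1 hβ
    refine (Submodule.mem_span_range_iff_exists_fun ℝ).2 ⟨c, ?_⟩
    have h1 := congrArg (pullPair E F ψ _) hc
    simp only [map_sum, map_smul] at h1
    exact h1.trans (Prod.ext rfl hαβ.symm)
  obtain ⟨f, hf, hfe⟩ := exists_smooth_coeff hw hrank hb hmem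
  refine ⟨f, hf, ?_, ?_⟩
  · filter_upwards [hfe] with e he
    have h := congrArg Prod.fst he
    rwa [Prod.fst_sum] at h
  · filter_upwards [hfe] with e he
    have h := congrArg Prod.snd he
    rwa [Prod.snd_sum] at h

end Regular

/-! ### Brackets at regular points -/

section Compat

variable {E : Type*} [NormedAddCommGroup E] [NormedSpace ℝ E]
  {F : Type*} [NormedAddCommGroup F] [NormedSpace ℝ F]
  {N : Type*} [TopologicalSpace N] [ChartedSpace E N]
  {M : Type*} [TopologicalSpace M] [ChartedSpace F M]

/-- The fibre of `L` at `x` as a subspace of `F × F*`, through the identification of `T_x M` with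
the model space by the preferred chart at `x`. -/
def fibre {F : Type*} [NormedAddCommGroup F] [NormedSpace ℝ F]
    {M : Type*} [TopologicalSpace M] [ChartedSpace F M] (L : SubFamily F M) (x : M) :
    Submodule ℝ (F × (F →L[ℝ] ℝ)) := L x

/-- Membership in the backward image at the base point of the charts, in coordinates. -/
theorem mem_backward_of_chart {ψ : N → M} (hψ : ContMDiff 𝓘(ℝ, E) 𝓘(ℝ, F) ∞ ψ)
    {L : SubFamily F M} {y : N} {P : F × (F →L[ℝ] ℝ)} (hP : P ∈ fibre L (ψ y)) {u : E}
    {a : E →L[ℝ] ℝ}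
    (h1 : fderiv ℝ (chartMap E F ψ y) (extChartAt 𝓘(ℝ, E) y y) u = P.1)
    (h2 : a = P.2.comp (fderiv ℝ (chartMap E F ψ y) (extChartAt 𝓘(ℝ, E) y y))) :
    ((u, a) : GTan E y) ∈ backward ψ L y := by
  refine ⟨P.2, ?_, ?_⟩
  · have h3 : tmap E F ψ y u = P.1 := (tmap_eq hψ y u).trans h1
    have h4 : ((tmap E F ψ y u, P.2) : GTan F (ψ y)) = P := Prod.ext h3 rfl
    exact h4 ▸ hP
  · refine h2.trans (ContinuousLinearMap.ext (M₁ := E) (M₂ := ℝ) fun v => ?_)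
    exact congrArg P.2 (tmap_eq hψ y v).symm

variable [IsManifold 𝓘(ℝ, E) ∞ N] [IsManifold 𝓘(ℝ, F) ∞ M]

/-- At a regular point the Courant–Dorfman bracket of sections of the backward image is a
combination of sections of `L` and of their brackets, pulled back along `ψ`. -/
theorem IsRegularPoint.courant_mem {ψ : N → M} (hψ : ContMDiff 𝓘(ℝ, E) 𝓘(ℝ, F) ∞ ψ)
    {L : SubFamily F M} (hL : IsDirac L) {y : N}
    (hy : IsRegularPoint (E := E) ψ L y) {X Y : VField E N} {α β : OneForm E N}
    (hXα : IsSection (backward ψ L) X α) (hYβ : IsSection (backward ψ L) Y β) :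
    ((bracket X Y y, (lieDer X β - iExtDeriv Y α) y) : GTan E y) ∈ backward ψ L y := by
  obtain ⟨k, Xi, αi, hsec, hdec⟩ := hy
  obtain ⟨f, hf, hdX, hdα⟩ := hdec X α hXα
  obtain ⟨g, hg, hdY, hdβ⟩ := hdec Y β hYβ
  set p := extChartAt 𝓘(ℝ, E) y y with hp
  set Ψ := chartMap E F ψ y with hΨ
  have hΨp : Ψ p = extChartAt 𝓘(ℝ, F) (ψ y) (ψ y) := chartMap_self ψ y
  have hd : ∀ {G : Type _} [NormedAddCommGroup G] [NormedSpace ℝ G] {g : F → G},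
      ContDiffAt ℝ ∞ g (extChartAt 𝓘(ℝ, F) (ψ y) (ψ y)) → DifferentiableAt ℝ g (Ψ p) :=
    fun h => hΨp ▸ h.differentiableAt (by simp)
  have hA' : ∀ i, ((chartV (Xi i) (ψ y) (Ψ p), chartForm (αi i) (ψ y) (Ψ p)) :
      F × (F →L[ℝ] ℝ)) = (Xi i (ψ y), αi i (ψ y)) := fun i => by
    rw [hΨp, chartV_self]
    exact Prod.ext rfl (ContinuousLinearMap.ext (M₁ := F) (M₂ := ℝ) (chartForm_self (αi i) (ψ y)))
  have hA : ∀ i, ((chartV (Xi i) (ψ y) (Ψ p), chartForm (αi i) (ψ y) (Ψ p)) :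
      F × (F →L[ℝ] ℝ)) ∈ fibre L (ψ y) := fun i => by
    rw [hA']
    exact (hsec i).mem (ψ y)
  have hiso : ∀ i j, chartForm (αi j) (ψ y) (Ψ p) (chartV (Xi i) (ψ y) (Ψ p)) +
      chartForm (αi i) (ψ y) (Ψ p) (chartV (Xi j) (ψ y) (Ψ p)) = 0 := fun i j =>
    (hL.mem_iff (ψ y) _).1 (hA i) _ (hA j)
  have h1 := fderiv_lieBracket_decomp (chartMap_contDiffAt hψ y)
    ((hXα.smooth_left.chartV y).differentiableAt (by simp))
    ((hYβ.smooth_left.chartV y).differentiableAt (by simp))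
    (fun i => hd ((hsec i).smooth_left.chartV (ψ y)))
    (fun i => (hf i).differentiableAt (by simp)) (fun i => (hg i).differentiableAt (by simp))
    hdX hdY
  have h2 := locCourant_decomp (chartMap_contDiffAt hψ y)
    ((hXα.smooth_left.chartV y).differentiableAt (by simp))
    (fun i => hd ((hsec i).smooth_left.chartV (ψ y)))
    (fun i => hd ((hsec i).smooth_right.chartForm (ψ y)))
    (fun i => (hf i).differentiableAt (by simp)) (fun i => (hg i).differentiableAt (by simp))
    hdX hdY hdα hdβ hiso
  have hC : ∀ i j, ((VectorField.lieBracket ℝ (chartV (Xi i) (ψ y)) (chartV (Xi j) (ψ y)) (Ψ p),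
      locCourant (chartV (Xi i) (ψ y)) (chartForm (αi i) (ψ y)) (chartV (Xi j) (ψ y))
        (chartForm (αi j) (ψ y)) (Ψ p)) : F × (F →L[ℝ] ℝ)) ∈ fibre L (ψ y) := fun i j => by
    have h3 := hL.involutive _ _ _ _ (hsec i) (hsec j) (ψ y)
    rw [bracket_eq, courant_eq (hsec i).smooth_left (hsec j).smooth_right, ← hΨp] at h3
    exact h3
  let P : F × (F →L[ℝ] ℝ) :=
    ∑ j, fderiv ℝ (g j) p (chartV X y p) •
      (chartV (Xi j) (ψ y) (Ψ p), chartForm (αi j) (ψ y) (Ψ p)) -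
    ∑ i, fderiv ℝ (f i) p (chartV Y y p) •
      (chartV (Xi i) (ψ y) (Ψ p), chartForm (αi i) (ψ y) (Ψ p)) +
    ∑ i, ∑ j, (f i p * g j p) •
      (VectorField.lieBracket ℝ (chartV (Xi i) (ψ y)) (chartV (Xi j) (ψ y)) (Ψ p),
        locCourant (chartV (Xi i) (ψ y)) (chartForm (αi i) (ψ y)) (chartV (Xi j) (ψ y))
        (chartForm (αi j) (ψ y)) (Ψ p))
  have hP : P ∈ fibre L (ψ y) := Submodule.add_mem _ (Submodule.sub_mem _
    (Submodule.sum_mem _ fun j _ => Submodule.smul_mem _ _ (hA j))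
    (Submodule.sum_mem _ fun j _ => Submodule.smul_mem _ _ (hA j)))
    (Submodule.sum_mem _ fun i _ => Submodule.sum_mem _ fun j _ =>
      Submodule.smul_mem _ _ (hC i j))
  rw [bracket_eq, courant_eq hXα.smooth_left hYβ.smooth_right]
  refine mem_backward_of_chart hψ hP (h1.trans ?_) (h2.trans ?_)
  · simp only [P, Prod.fst_add, Prod.fst_sub, Prod.fst_sum, Prod.smul_fst]
    rfl
  · simp only [P, Prod.snd_add, Prod.snd_sub, Prod.snd_sum, Prod.smul_snd]
    rfl

variable [FiniteDimensional ℝ F] [T2Space M]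

/-- At a regular point `y`, for `(Y, α) = ∑ fᵢ (Yᵢ, αᵢ)` along `ψ` and a vector field `V` on `M`
with `V = dψ(X)` at `ψ y`, the pair `(D^r_X Y, D^{r,*}_X α)` is pulled back from
`∑ fᵢ (D_V Yᵢ, D^*_V αᵢ) + (X fᵢ) (r, r^*)(Yᵢ, αᵢ) - ((rX) fᵢ) (Yᵢ, αᵢ)`, which lies in `L`. -/
theorem IsRegularPoint.opD_mem {ψ : N → M} (hψ : ContMDiff 𝓘(ℝ, E) 𝓘(ℝ, F) ∞ ψ)
    {L : SubFamily F M} {rN : Tensor11 E N} {rM : Tensor11 F M} (hrN : SmoothTensor11 rN)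
    (hrM : SmoothTensor11 rM) (hcomp : IsCompatible L rM) (hrel : AreRelated ψ rN rM) {y : N}
    (hy : IsRegularPoint (E := E) ψ L y) {X Y : VField E N} {α : OneForm E N}
    (hX : SmoothVField X) (hYα : IsSection (backward ψ L) Y α) :
    ((opD rN X Y y, opDStar rN X α y) : GTan E y) ∈ backward ψ L y := by
  obtain ⟨k, Yi, αi, hsec, hdec⟩ := hy
  obtain ⟨f, hf, hdY, hdα⟩ := hdec Y α hYα
  obtain ⟨V, hV, hVy⟩ := exists_smoothVField_eq (E := F) (ψ y) (tmap E F ψ y (X y))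
  set p := extChartAt 𝓘(ℝ, E) y y with hp
  set Ψ := chartMap E F ψ y with hΨ
  set x := chartV X y p with hx
  have hΨp : Ψ p = extChartAt 𝓘(ℝ, F) (ψ y) (ψ y) := chartMap_self ψ y
  have hVx : chartV V (ψ y) (Ψ p) = fderiv ℝ Ψ p x := by
    rw [hΨp, chartV_self, hVy]
    exact (tmap_eq hψ y (X y)).trans (congrArg _ (chartV_self X y).symm)
  have hd : ∀ {G : Type _} [NormedAddCommGroup G] [NormedSpace ℝ G] {g : F → G},
      ContDiffAt ℝ ∞ g (extChartAt 𝓘(ℝ, F) (ψ y) (ψ y)) → DifferentiableAt ℝ g (Ψ p) :=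
    fun h => hΨp ▸ h.differentiableAt (by simp)
  have h1 := fderiv_locD (x := x) (chartMap_contDiffAt hψ y)
    ((hrN.chartT y).differentiableAt (by simp)) (hd (hrM.chartT (ψ y)))
    (hrel.eventually_chart hψ y)
    ((hYα.smooth_left.chartV y).differentiableAt (by simp))
    (fun i => hd ((hsec i).smooth_left.chartV (ψ y)))
    (fun i => (hf i).differentiableAt (by simp)) hdY
  have h2 := locDStar_decomp (x := x) (chartMap_contDiffAt hψ y)
    ((hrN.chartT y).differentiableAt (by simp)) (hd (hrM.chartT (ψ y)))
    (hrel.eventually_chart hψ y)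
    (fun i => hd ((hsec i).smooth_right.chartForm (ψ y)))
    (fun i => (hf i).differentiableAt (by simp)) hdα
  have hA : ∀ i, ((chartV (Yi i) (ψ y) (Ψ p), chartForm (αi i) (ψ y) (Ψ p)) :
      F × (F →L[ℝ] ℝ)) ∈ fibre L (ψ y) := fun i => by
    have h3 : ((chartV (Yi i) (ψ y) (Ψ p), chartForm (αi i) (ψ y) (Ψ p)) : F × (F →L[ℝ] ℝ)) =
        (Yi i (ψ y), αi i (ψ y)) := by
      rw [hΨp, chartV_self]
      exact Prod.ext rfl (ContinuousLinearMap.ext (M₁ := F) (M₂ := ℝ) (chartForm_self (αi i) (ψ y)))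
    rw [h3]
    exact (hsec i).mem (ψ y)
  have hB : ∀ i, ((chartT rM (ψ y) (Ψ p) (chartV (Yi i) (ψ y) (Ψ p)),
      (chartForm (αi i) (ψ y) (Ψ p)).comp (chartT rM (ψ y) (Ψ p))) :
      F × (F →L[ℝ] ℝ)) ∈ fibre L (ψ y) := fun i => by
    have h3 := hcomp.map_mem (ψ y) _ (hA i)
    have h4 : chartT rM (ψ y) (Ψ p) = (rM (ψ y) : F →L[ℝ] F) := by
      rw [hΨp]
      exact ContinuousLinearMap.ext (M₁ := F) (M₂ := F) (chartT_self rM (ψ y))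
    rw [h4]
    exact h3
  have hC : ∀ i, ((locD (chartT rM (ψ y)) (fderiv ℝ Ψ p x) (chartV (Yi i) (ψ y)) (Ψ p),
      locDStar (chartT rM (ψ y)) (fderiv ℝ Ψ p x) (chartForm (αi i) (ψ y)) (Ψ p)) :
      F × (F →L[ℝ] ℝ)) ∈ fibre L (ψ y) := fun i => by
    have h3 := hcomp.deriv_mem V (Yi i) (αi i) hV (hsec i) (ψ y)
    rw [opD_eq hrM hV, opDStar_eq hrM (hsec i).smooth_right, ← hΨp, hVx] at h3
    exact h3
  let P : F × (F →L[ℝ] ℝ) := ∑ i, (f i p • (locD (chartT rM (ψ y)) (fderiv ℝ Ψ p x)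
      (chartV (Yi i) (ψ y)) (Ψ p),
        locDStar (chartT rM (ψ y)) (fderiv ℝ Ψ p x) (chartForm (αi i) (ψ y)) (Ψ p)) +
      fderiv ℝ (f i) p x • (chartT rM (ψ y) (Ψ p) (chartV (Yi i) (ψ y) (Ψ p)),
        (chartForm (αi i) (ψ y) (Ψ p)).comp (chartT rM (ψ y) (Ψ p))) -
      fderiv ℝ (f i) p (chartT rN y p x) •
        (chartV (Yi i) (ψ y) (Ψ p), chartForm (αi i) (ψ y) (Ψ p)))
  have hP : P ∈ fibre L (ψ y) := Submodule.sum_mem _ fun i _ => Submodule.sub_mem _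
    (Submodule.add_mem _ (Submodule.smul_mem _ _ (hC i)) (Submodule.smul_mem _ _ (hB i)))
    (Submodule.smul_mem _ _ (hA i))
  rw [opD_eq hrN hX, opDStar_eq hrN hYα.smooth_right]
  refine mem_backward_of_chart hψ hP (h1.trans ?_) (h2.trans ?_)
  · rw [Prod.fst_sum]
    rfl
  · rw [Prod.snd_sum]
    rfl

end Compat

/-! ### Backward images of lagrangian subspaces -/

section Linear

variable {V W : Type*} [NormedAddCommGroup V] [NormedSpace ℝ V]
  [NormedAddCommGroup W] [NormedSpace ℝ W]

/-- Every linear functional on `W ⊕ W*` is the pairing with a vector. -/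
theorem exists_eq_pairing [FiniteDimensional ℝ W] (f : W × (W →L[ℝ] ℝ) →ₗ[ℝ] ℝ) :
    ∃ (w : W) (β : W →L[ℝ] ℝ), ∀ p : W × (W →L[ℝ] ℝ), f p = p.2 w + β p.1 := by
  refine ⟨(Module.evalEquiv ℝ W).symm
    ((f.comp (LinearMap.inr ℝ W (W →L[ℝ] ℝ))).comp LinearMap.toContinuousLinearMap.toLinearMap),
    LinearMap.toContinuousLinearMap (f.comp (LinearMap.inl ℝ W (W →L[ℝ] ℝ))), fun p => ?_⟩
  have h := Module.apply_evalEquiv_symm_apply ℝ W (p.2 : W →ₗ[ℝ] ℝ)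
    ((f.comp (LinearMap.inr ℝ W (W →L[ℝ] ℝ))).comp LinearMap.toContinuousLinearMap.toLinearMap)
  refine Eq.trans ?_ (congrArg₂ (fun a b : ℝ => a + b) h.symm rfl)
  have h2 : LinearMap.toContinuousLinearMap (p.2 : W →ₗ[ℝ] ℝ) = p.2 := by ext; rfl
  simp only [LinearMap.comp_apply, LinearEquiv.coe_coe, h2, LinearMap.inr_apply,
    LinearMap.coe_toContinuousLinearMap', LinearMap.inl_apply]
  rw [← map_add]
  simp

/-- A functional that vanishes on `ker T` factors through `T`. -/
theorem exists_comp_eq [FiniteDimensional ℝ W] (T : V →L[ℝ] W)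
    (α : V →L[ℝ] ℝ) (h : ∀ z, T z = 0 → α z = 0) : ∃ β : W →L[ℝ] ℝ, α = β.comp T := by
  have h1 : (α : V →ₗ[ℝ] ℝ) ∈ LinearMap.range (T : V →ₗ[ℝ] W).dualMap := by
    rw [LinearMap.range_dualMap_eq_dualAnnihilator_ker, Submodule.mem_dualAnnihilator]
    exact fun z hz => h z hz
  obtain ⟨β, hβ⟩ := h1
  refine ⟨LinearMap.toContinuousLinearMap β, ?_⟩
  ext z
  exact (congrArg (fun f => f z) hβ).symm

/-- The backward image of a maximal isotropic subspace is maximal isotropic. The nontrivial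
inclusion rests on `(L ∩ P)^⊥ = L + P^⊥` for `P = im T ⊕ W*`. -/
theorem backward_maximal [FiniteDimensional ℝ W] (T : V →L[ℝ] W)
    {L : Submodule ℝ (W × (W →L[ℝ] ℝ))}
    (hL : ∀ p : W × (W →L[ℝ] ℝ), p ∈ L ↔ ∀ q ∈ L, q.2 p.1 + p.2 q.1 = 0)
    {X : V} {α : V →L[ℝ] ℝ}
    (h : ∀ (Z : V) (β : W →L[ℝ] ℝ), (T Z, β) ∈ L → β (T X) + α Z = 0) :
    ∃ β : W →L[ℝ] ℝ, (T X, β) ∈ L ∧ α = β.comp T := by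
  obtain ⟨β₀, rfl⟩ := exists_comp_eq T α fun z hz => by
    have := h z 0 (by rw [hz]; exact L.zero_mem)
    simpa using this
  -- `Q = P^⊥ = 0 ⊕ ann(im T)`.
  let Q : Submodule ℝ (W × (W →L[ℝ] ℝ)) :=
    { carrier := {p | p.1 = 0 ∧ p.2.comp T = 0}
      add_mem' := fun {a b} ha hb => ⟨by simp [ha.1, hb.1], by
        rw [Prod.snd_add, ContinuousLinearMap.add_comp, ha.2, hb.2, add_zero]⟩
      zero_mem' := ⟨rfl, ContinuousLinearMap.zero_comp T⟩
      smul_mem' := fun c a ha => ⟨by simp [ha.1], by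
        rw [Prod.smul_snd, ContinuousLinearMap.smul_comp, ha.2, smul_zero]⟩ }
  have key : (T X, β₀) ∈ L ⊔ Q := by
    by_contra hK
    obtain ⟨f, hf, hker⟩ := Submodule.exists_le_ker_of_notMem hK
    obtain ⟨w, β, hwβ⟩ := exists_eq_pairing f
    have h1 : (w, β) ∈ L := (hL _).2 fun q hq =>
      (hwβ q).symm.trans (LinearMap.mem_ker.1 (hker (Submodule.mem_sup_left hq)))
    obtain ⟨Z, rfl⟩ : ∃ Z, T Z = w := by
      by_contra hw
      obtain ⟨g, hg, hker'⟩ := Submodule.exists_le_ker_of_notMem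
        (p := LinearMap.range (T : V →ₗ[ℝ] W)) (v := w) hw
      have h2 : ((0 : W), LinearMap.toContinuousLinearMap g) ∈ Q :=
        ⟨rfl, ContinuousLinearMap.ext fun v => hker' ⟨v, rfl⟩⟩
      have h3 := (hwβ _).symm.trans (LinearMap.mem_ker.1 (hker (Submodule.mem_sup_right h2)))
      exact hg (by simpa using h3)
    refine hf ((hwβ _).trans ?_)
    rw [add_comm]
    exact h Z β h1
  obtain ⟨l, hl, q, hq, hlq⟩ := Submodule.mem_sup.1 key
  refine ⟨l.2, ?_, ?_⟩
  · have h1 : (T X, l.2) = l := by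
      refine Prod.ext ?_ rfl
      have := congrArg Prod.fst hlq
      rw [Prod.fst_add, hq.1, add_zero] at this
      exact this.symm
    rwa [h1]
  · have := congrArg (fun p => ContinuousLinearMap.comp p.2 T) hlq
    simp only [Prod.snd_add, ContinuousLinearMap.add_comp, hq.2, add_zero] at this
    exact this.symm

end Linear

/-! ### Backward images of Dirac structures -/

section Backward

variable {E : Type*} [NormedAddCommGroup E] [NormedSpace ℝ E]
  {F : Type*} [NormedAddCommGroup F] [NormedSpace ℝ F] [FiniteDimensional ℝ F]
  {N : Type*} [TopologicalSpace N] [ChartedSpace E N]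
  {M : Type*} [TopologicalSpace M] [ChartedSpace F M]

theorem mem_backward_iff {ψ : N → M} {L : SubFamily F M} {x : N}
    (hL : ∀ p : GTan F (ψ x), p ∈ L (ψ x) ↔ ∀ q ∈ L (ψ x), pairing p q = 0) (p : GTan E x) :
    p ∈ backward ψ L x ↔ ∀ q ∈ backward (E := E) ψ L x, pairing p q = 0 := by
  constructor
  · rintro ⟨β, hβ, hp⟩ q ⟨γ, hγ, hq⟩
    have h := (hL _).1 hβ _ hγ
    refine Eq.trans ?_ h
    rw [pairing, hp, hq]
    rfl
  · intro h
    refine backward_maximal (V := E) (W := F) (tmap E F ψ x) (L := fibre L (ψ x)) hL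
      (X := p.1) (α := p.2) fun Z β hβ => ?_
    exact h (Z, ContinuousLinearMap.comp β (tmap E F ψ x)) ⟨β, hβ, rfl⟩

variable [IsManifold 𝓘(ℝ, E) ∞ N] [IsManifold 𝓘(ℝ, F) ∞ M]
  {ψ : N → M} {L : SubFamily F M}

theorem IsLagrangian.backward (hL : IsLagrangian L)
    (hB : IsSubbundle (DiracGeom.backward (E := E) ψ L)) :
    IsLagrangian (DiracGeom.backward (E := E) ψ L) :=
  ⟨hB, fun x p => mem_backward_iff (hL.mem_iff (ψ x)) p⟩

variable [FiniteDimensional ℝ E] [T2Space N] [T2Space M]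

/-- Involutivity holds at regular points, hence everywhere because these are dense. -/
theorem IsDirac.backward (hψ : ContMDiff 𝓘(ℝ, E) 𝓘(ℝ, F) ∞ ψ) (hL : IsDirac L)
    (hB : IsSubbundle (DiracGeom.backward (E := E) ψ L)) :
    IsDirac (DiracGeom.backward (E := E) ψ L) := by
  refine ⟨hL.toIsLagrangian.backward hB, fun X Y α β hX hY => ?_⟩
  refine (hL.toIsLagrangian.backward hB).mem_of_dense (fun x =>
    ((DiracGeom.bracket X Y x, (lieDer X β - iExtDeriv Y α) x) : GTan E x)) ?_
    (dense_isRegularPoint hψ hL.subbundle) fun y hy => hy.courant_mem hψ hL hX hY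
  have := FiniteDimensional.complete ℝ E
  exact fun Z γ hZ => continuous_pairing_courant hX.smooth_left hY.smooth_left hZ.smooth_left
    hX.smooth_right hY.smooth_right hZ.smooth_right

/-- Compatibility passes to backward images: the derivative condition holds at regular points,
hence everywhere because these are dense. -/
theorem IsCompatible.backward (hψ : ContMDiff 𝓘(ℝ, E) 𝓘(ℝ, F) ∞ ψ) (hL : IsSubbundle L)
    (hB : IsLagrangian (DiracGeom.backward (E := E) ψ L)) {rN : Tensor11 E N}
    {rM : Tensor11 F M} (hrN : SmoothTensor11 rN) (hrM : SmoothTensor11 rM)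
    (hcomp : IsCompatible L rM) (hrel : AreRelated ψ rN rM) :
    IsCompatible (DiracGeom.backward (E := E) ψ L) rN := by
  refine ⟨?_, fun X Y α hX hY => ?_⟩
  · rintro x p ⟨β, hβ, hp⟩
    refine ⟨ContinuousLinearMap.comp β (rM (ψ x)), ?_, ?_⟩
    · have h := hcomp.map_mem _ _ hβ
      rw [hrel] at h
      exact h
    · rw [hp]
      exact ContinuousLinearMap.ext (M₁ := E) (M₂ := ℝ) fun v => congrArg β (hrel x v).symm
  · refine hB.mem_of_dense (fun x => ((opD rN X Y x, opDStar rN X α x) : GTan E x)) ?_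
      (dense_isRegularPoint hψ hL) fun y hy => hy.opD_mem hψ hrN hrM hcomp hrel hX hY
    have := FiniteDimensional.complete ℝ E
    exact fun Z γ hZ => continuous_pairing_opD hrN hX hY.smooth_left hZ.smooth_left
      hY.smooth_right hZ.smooth_right

end Backward

/-! ### The restriction of a tensor to an invariant submanifold -/

section Restrict

variable {E : Type*} [NormedAddCommGroup E] [NormedSpace ℝ E]
  {F : Type*} [NormedAddCommGroup F] [NormedSpace ℝ F]
  {N : Type*} [TopologicalSpace N] [ChartedSpace E N]
  {M : Type*} [TopologicalSpace M] [ChartedSpace F M] {ψ : N → M}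

theorem fderiv_chartMap_injective (hψ : IsSubmanifold E F ψ) (x : N) :
    Function.Injective (fderiv ℝ (chartMap E F ψ x) (extChartAt 𝓘(ℝ, E) x x)) := by
  intro u v h
  refine hψ.immersion x (a₁ := u) (a₂ := v) ?_
  exact (tmap_eq hψ.smooth x u).trans (h.trans (tmap_eq hψ.smooth x v).symm)

variable [FiniteDimensional ℝ F] [IsManifold 𝓘(ℝ, E) ∞ N] [IsManifold 𝓘(ℝ, F) ∞ M]

/-- An invariant submanifold inherits a tensor field. It is smooth because in coordinates it is
`C ∘ r_M ∘ dψ` for a smooth family `C` of left inverses of `dψ`. -/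
theorem exists_restrict [FiniteDimensional ℝ E] (hψ : IsSubmanifold E F ψ) {rM : Tensor11 F M}
    (hrM : SmoothTensor11 rM) (hinv : IsInvariant E ψ rM) :
    ∃ rN : Tensor11 E N, SmoothTensor11 rN ∧ AreRelated ψ rN rM := by
  have hB : ∀ x : N, ∃ B : Tan F (ψ x) →L[ℝ] Tan E x, ∀ v, B (tmap E F ψ x v) = v := fun x => by
    obtain ⟨B, hB⟩ := LinearMap.exists_leftInverse_of_injective (K := ℝ) (V := E) (V' := F)
      (tmap E F ψ x : E →L[ℝ] F).toLinearMap (LinearMap.ker_eq_bot.2 (hψ.immersion x))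
    exact ⟨(LinearMap.toContinuousLinearMap B : F →L[ℝ] E), fun v => congrArg (fun f : E →ₗ[ℝ] E => f v) hB⟩
  choose B hB using hB
  let rN : Tensor11 E N := fun x => (B x).comp ((rM (ψ x)).comp (tmap E F ψ x))
  have hrel : AreRelated ψ rN rM := fun x v => by
    obtain ⟨w, hw⟩ := hinv x v
    have h1 : rN x v = w := (congrArg (B x) hw.symm).trans (hB x w)
    rw [h1, hw]
  refine ⟨rN, fun x => (contMDiffAt_tensor_iff rN x).2 ?_, hrel⟩
  have hΨ := chartMap_contDiffAt hψ.smooth x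
  have hD : ContDiffAt ℝ ∞ (fderiv ℝ (chartMap E F ψ x)) (extChartAt 𝓘(ℝ, E) x x) :=
    hΨ.fderiv_right (m := ∞) (by simp)
  obtain ⟨C, hC, hCD⟩ := exists_smooth_leftInverse hD (fderiv_chartMap_injective hψ x)
  have hR : ContDiffAt ℝ ∞ (fun e => chartT rM (ψ x) (chartMap E F ψ x e))
      (extChartAt 𝓘(ℝ, E) x x) :=
    ContDiffAt.comp (g := chartT rM (ψ x)) _ (by rw [chartMap_self]; exact hrM.chartT (ψ x)) hΨ
  refine (hC.clm_comp (hR.clm_comp hD)).congr_of_eventuallyEq ?_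
  filter_upwards [hrel.eventually_chart hψ.smooth x, hCD] with e he hCe
  rw [he, ← ContinuousLinearMap.comp_assoc, hCe, ContinuousLinearMap.id_comp]

variable [T2Space M]

/-- Along an immersion, the torsions of related tensors are related. -/
theorem IsNijenhuis.of_areRelated (hψ : IsSubmanifold E F ψ) {rN : Tensor11 E N}
    {rM : Tensor11 F M} (hrN : SmoothTensor11 rN) (hrM : SmoothTensor11 rM)
    (hrel : AreRelated ψ rN rM) (h : IsNijenhuis rM) : IsNijenhuis rN := by
  intro X Y hX hY x
  rw [torsion_eq hrN hX hY]
  obtain ⟨V, hV, hVx⟩ := exists_smoothVField_eq (E := F) (ψ x) (tmap E F ψ x (X x))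
  obtain ⟨W, hW, hWx⟩ := exists_smoothVField_eq (E := F) (ψ x) (tmap E F ψ x (Y x))
  refine fderiv_chartMap_injective hψ x ?_
  rw [fderiv_locTorsion (chartMap_contDiffAt hψ.smooth x)
    ((hrN.chartT x).differentiableAt (by simp))
    (by rw [chartMap_self]; exact (hrM.chartT (ψ x)).differentiableAt (by simp))
    (hrel.eventually_chart hψ.smooth x)]
  have h1 := (torsion_eq hrM hV hW (ψ x)).symm.trans (h V W hV hW (ψ x))
  rw [chartV_self, chartV_self, hVx, hWx] at h1
  refine Eq.trans ?_ (h1.trans (map_zero _).symm)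
  rw [chartMap_self, chartV_self, chartV_self]
  exact congrArg₂ (fun a b : F => locTorsion (chartT rM (ψ x)) a b _)
    (tmap_eq hψ.smooth x (X x)).symm (tmap_eq hψ.smooth x (Y x)).symm

end Restrict

/-! ### Graphs of two-forms -/

section Graph

variable {E : Type*} [NormedAddCommGroup E] [NormedSpace ℝ E]
  {M : Type*} [TopologicalSpace M] [ChartedSpace E M]

theorem mem_graph_iff {Ω : BilinField E M} {x : M} {p : GTan E x} :
    p ∈ graph Ω x ↔ p.2 = Ω x p.1 := LinearMap.mem_graph_iff _ _

variable [IsManifold 𝓘(ℝ, E) ∞ M]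

theorem IsTwoForm.smoothOneForm {Ω : BilinField E M} (hΩ : IsTwoForm Ω) {X : VField E M}
    (hX : SmoothVField X) : SmoothOneForm fun x => Ω x (X x) :=
  contMDiffOn_univ.2 (ContMDiff.clm_bundle_apply hΩ.smooth (contMDiffOn_univ.1 hX))

theorem IsTwoForm.isSection {Ω : BilinField E M} (hΩ : IsTwoForm Ω) {X : VField E M}
    (hX : SmoothVField X) : IsSection (graph Ω) X fun x => Ω x (X x) :=
  ⟨hX, hΩ.smoothOneForm hX, fun _ => mem_graph_iff.2 rfl⟩

theorem IsTwoForm.neg_flip {Ω : BilinField E M} (hΩ : IsTwoForm Ω) (x : M) (u v : Tan E x) :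
    Ω x u v = -Ω x v u := by
  have h := hΩ.alternating x (u + v)
  have h1 : Ω x (u + v) (u + v) = (Ω x u u + Ω x v u) + (Ω x u v + Ω x v v) := by
    have h2 : ∀ w, Ω x (u + v) w = Ω x u w + Ω x v w := fun w =>
      congrArg (fun T => T w) (map_add (Ω x) u v)
    rw [h2, map_add, map_add]
    exact add_add_add_comm (G := ℝ) _ _ _ _
  rw [h1, hΩ.alternating, hΩ.alternating] at h
  exact eq_neg_of_add_eq_zero_right (by simpa using h)

/-- A two-form with involutive graph is closed. -/
theorem IsTwoForm.isClosedTwoForm {Ω : BilinField E M} (hΩ : IsTwoForm Ω)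
    (hinv : ∀ (X Y : VField E M) (α β : OneForm E M), IsSection (graph Ω) X α →
      IsSection (graph Ω) Y β →
      ∀ x : M, ((bracket X Y x, (lieDer X β - iExtDeriv Y α) x) : GTan E x) ∈ graph Ω x) :
    IsClosedTwoForm Ω := by
  intro X Y Z hX hY hZ x
  have h := mem_graph_iff.1 (hinv X Y _ _ (hΩ.isSection hX) (hΩ.isSection hY) x)
  have h1 : lieDer X (fun y => Ω y (Y y)) x (Z x) - iExtDeriv Y (fun y => Ω y (X y)) x (Z x) =
      Ω x (bracket X Y x) (Z x) := congrArg (fun T => T (Z x)) h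
  rw [lieDer_apply_eq (hΩ.smoothOneForm hY) hX hZ,
    iExtDeriv_apply_eq (hΩ.smoothOneForm hX) hY hZ, hΩ.neg_flip x (Y x) (bracket X Z x),
    hΩ.neg_flip x (X x) (bracket Y Z x)] at h1
  rw [← h1]
  have hring : ∀ a b c d e : ℝ, a - b + c - (a - -d - (b - c - -e)) + d - e = 0 := by
    intros; ring
  exact hring _ _ _ _ _

theorem IsCompatible.isFormCompatible {Ω : BilinField E M} (hΩ : IsTwoForm Ω)
    {r : Tensor11 E M} (h : IsCompatible (graph Ω) r) : IsFormCompatible Ω r :=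
  ⟨fun x u => (mem_graph_iff.1 (h.map_mem x (u, Ω x u) (mem_graph_iff.2 rfl))).symm,
    fun X Y hX hY x => mem_graph_iff.1 (h.deriv_mem X Y _ hX (hΩ.isSection hY) x)⟩

/-- A frame `X_a` of the tangent bundle gives the frame `(X_a, Ω X_a)` of the graph. -/
theorem IsTwoForm.isSubbundle_graph [FiniteDimensional ℝ E] [T2Space M] {Ω : BilinField E M}
    (hΩ : IsTwoForm Ω) : IsSubbundle (graph Ω) := by
  intro x₀
  let b := Module.finBasis ℝ E
  have hE : ∀ v : Fin (Module.finrank ℝ E) → E, LinearIndependent ℝ v →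
      Submodule.span ℝ (Set.range v) = ⊤ := fun v hv =>
    hv.span_eq_top_of_card_eq_finrank' (by simp)
  choose X hX hXb using fun a => exists_smoothVField_eq (E := E) x₀ (b a)
  have hcont : ContinuousAt (fun x a => chartV (X a) x₀ (extChartAt 𝓘(ℝ, E) x₀ x)) x₀ :=
    continuousAt_pi.2 fun a => ContinuousAt.comp (f := extChartAt 𝓘(ℝ, E) x₀)
      (g := chartV (X a) x₀) ((hX a).chartV x₀).continuousAt (continuousAt_extChartAt x₀)
  have hli : LinearIndependent ℝ fun a => chartV (X a) x₀ (extChartAt 𝓘(ℝ, E) x₀ x₀) := by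
    have h : (fun a => chartV (X a) x₀ (extChartAt 𝓘(ℝ, E) x₀ x₀)) = b :=
      funext fun a => (chartV_self (X a) x₀).trans (hXb a)
    rw [h]
    exact b.linearIndependent
  obtain ⟨U, hU, hUo, hx₀⟩ := eventually_nhds_iff.1
    ((hcont.eventually hli.eventually).and (extChartAt_source_mem_nhds (I := 𝓘(ℝ, E)) x₀))
  refine ⟨U, hUo, hx₀, _, X, fun a x => Ω x (X a x), fun a => (hX a).mono (Set.subset_univ U),
    fun a => (hΩ.smoothOneForm (hX a)).mono (Set.subset_univ U), fun x hx => ?_⟩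
  obtain ⟨h1, h2⟩ := hU x hx
  have h3 : LinearIndependent ℝ (fun a => X a x) := by
    refine LinearIndependent.of_comp (chartD x₀ x).toLinearMap ?_
    have h4 : ((chartD x₀ x).toLinearMap ∘ fun a => X a x) =
        fun a => chartV (X a) x₀ (extChartAt 𝓘(ℝ, E) x₀ x) :=
      funext fun a => (chartV_extChartAt (X a) h2).symm
    rw [h4]
    exact h1
  refine ⟨LinearIndependent.of_comp (LinearMap.fst ℝ (Tan E x) (Cot E x)) h3,
    le_antisymm (Submodule.span_le.2 ?_) ?_⟩
  · rintro _ ⟨a, rfl⟩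
    exact mem_graph_iff.2 rfl
  · intro p hp
    have htop : Submodule.span ℝ (Set.range fun a => X a x) = ⊤ :=
      hE _ h3
    obtain ⟨c, hc⟩ := (Submodule.mem_span_range_iff_exists_fun ℝ).1
      (htop ▸ Submodule.mem_top : p.1 ∈ Submodule.span ℝ (Set.range fun a => X a x))
    refine (Submodule.mem_span_range_iff_exists_fun ℝ).2 ⟨c, ?_⟩
    refine Prod.ext ?_ ?_
    · rw [Prod.fst_sum, ← hc]
      rfl
    · rw [Prod.snd_sum, mem_graph_iff.1 hp, ← hc, map_sum]
      simp only [Prod.smul_snd, map_smul]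

end Graph

/-! ### Integral submanifolds -/

section Integral

/-- A subspace `L` of `W ⊕ W*` that is isotropic and projects onto `im T` induces a bilinear
form on the domain of `T`. -/
theorem exists_presymplectic {V W : Type*} [NormedAddCommGroup V] [NormedSpace ℝ V]
    [FiniteDimensional ℝ V] [NormedAddCommGroup W] [NormedSpace ℝ W] (T : V →L[ℝ] W)
    {L : Submodule ℝ (W × (W →L[ℝ] ℝ))}
    (hL : ∀ p ∈ L, ∀ q ∈ L, q.2 p.1 + p.2 q.1 = 0) (hT : ∀ v, ∃ β, (T v, β) ∈ L) :
    ∃ σ : V →L[ℝ] V →L[ℝ] ℝ, ∀ v β, (T v, β) ∈ L → σ v = β.comp T := by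
  choose B hB using hT
  -- Both functionals are determined on `im T` by isotropy, paired against `(T w, B w)`.
  have huniq : ∀ v β, (T v, β) ∈ L → (B v).comp T = β.comp T := by
    intro v β h
    ext w
    have h1 := hL _ (hB v) _ (hB w)
    have h2 := hL _ h _ (hB w)
    simp only [ContinuousLinearMap.comp_apply] at *
    linarith
  let σ : V →ₗ[ℝ] V →L[ℝ] ℝ :=
    { toFun := fun v => (B v).comp T
      map_add' := fun v w => by
        rw [← ContinuousLinearMap.add_comp]
        refine huniq _ _ ?_
        rw [map_add]
        exact L.add_mem (hB v) (hB w)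
      map_smul' := fun c v => by
        rw [RingHom.id_apply, ← ContinuousLinearMap.smul_comp]
        refine huniq _ _ ?_
        rw [map_smul]
        exact L.smul_mem c (hB v) }
  exact ⟨LinearMap.toContinuousLinearMap σ, huniq⟩

variable {E : Type*} [NormedAddCommGroup E] [NormedSpace ℝ E]
  {F : Type*} [NormedAddCommGroup F] [NormedSpace ℝ F]
  {N : Type*} [TopologicalSpace N] [ChartedSpace E N]
  {M : Type*} [TopologicalSpace M] [ChartedSpace F M] {ψ : N → M} {L : SubFamily F M}

theorem IsIntegral.isInvariant (h : IsIntegral E ψ L) {r : Tensor11 F M}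
    (hr : ∀ (x : M) (p : GTan F x), p ∈ L x → ((r x p.1, p.2.comp (r x)) : GTan F x) ∈ L x) :
    IsInvariant E ψ r := by
  intro x v
  obtain ⟨β, hβ⟩ := (h x _).1 ⟨v, rfl⟩
  exact (h x _).2 ⟨_, hr _ _ hβ⟩

/-- The presymplectic form of an integral submanifold, fibrewise: `Ω(v) = β ∘ Tψ` for every `β`
with `(Tψ(v), β) ∈ L`. -/
theorem IsIntegral.exists_bilinField [FiniteDimensional ℝ E] (h : IsIntegral E ψ L)
    (hL : ∀ x, ∀ p ∈ L x, ∀ q ∈ L x, pairing p q = 0) :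
    ∃ Ω : BilinField E N, (∀ x u, Ω x u u = 0) ∧
      ∀ (x : N) (v : Tan E x) (β : Cot F (ψ x)), ((tmap E F ψ x v, β) : GTan F (ψ x)) ∈ L (ψ x) →
        Ω x v = β.comp (tmap E F ψ x) := by
  have key : ∀ x : N, ∃ σ : Tan E x →L[ℝ] Cot E x, ∀ (v : Tan E x) (β : Cot F (ψ x)),
      ((tmap E F ψ x v, β) : GTan F (ψ x)) ∈ L (ψ x) → σ v = β.comp (tmap E F ψ x) := fun x =>
    exists_presymplectic (V := E) (W := F) (tmap E F ψ x) (L := fibre L (ψ x)) (hL (ψ x))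
      fun v => (h x _).1 ⟨v, rfl⟩
  choose Ω hΩ using key
  refine ⟨Ω, fun x u => ?_, hΩ⟩
  obtain ⟨β, hβ⟩ := (h x _).1 ⟨u, rfl⟩
  rw [hΩ x u β hβ]
  have h1 : β (tmap E F ψ x u) + β (tmap E F ψ x u) = (0 : ℝ) := hL _ _ hβ _ hβ
  exact self_eq_neg.1 (eq_neg_of_add_eq_zero_left h1)

theorem IsIntegral.backward_eq_graph (h : IsIntegral E ψ L) {Ω : BilinField E N}
    (hΩ : ∀ (x : N) (v : Tan E x) (β : Cot F (ψ x)),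
      ((tmap E F ψ x v, β) : GTan F (ψ x)) ∈ L (ψ x) → Ω x v = β.comp (tmap E F ψ x)) :
    backward ψ L = graph Ω := by
  funext x
  ext p
  rw [mem_graph_iff]
  constructor
  · rintro ⟨β, hβ, hp⟩
    exact hp.trans (hΩ x p.1 β hβ).symm
  · intro hp
    obtain ⟨β, hβ⟩ := (h x _).1 ⟨p.1, rfl⟩
    exact ⟨β, hβ, hp.trans (hΩ x p.1 β hβ)⟩

variable [FiniteDimensional ℝ E] [FiniteDimensional ℝ F]
  [IsManifold 𝓘(ℝ, E) ∞ N] [T2Space M] [IsManifold 𝓘(ℝ, F) ∞ M]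

/-- The presymplectic form is smooth. In the coordinates at `x`, finitely many sections
`(Xᵢ, αᵢ)` of `L` project to smooth fields spanning the constant-rank image of `dψ`, so `dψ(u)` is
a smooth combination `∑ fᵢ Xᵢ` and `Ω(u) = ∑ fᵢ ψ^*αᵢ`. -/
theorem IsIntegral.isTwoForm (hψ : IsSubmanifold E F ψ) (hL : IsSubbundle L)
    (h : IsIntegral E ψ L) {Ω : BilinField E N} (halt : ∀ x u, Ω x u u = 0)
    (hΩ : ∀ (x : N) (v : Tan E x) (β : Cot F (ψ x)),
      ((tmap E F ψ x v, β) : GTan F (ψ x)) ∈ L (ψ x) → Ω x v = β.comp (tmap E F ψ x)) :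
    IsTwoForm Ω := by
  refine ⟨halt, fun x => contMDiffAt_bilin Ω x fun u => ?_⟩
  obtain ⟨k, Xi, αi, hsec, hspan⟩ := hL.exists_sections_span (ψ x)
  set p := extChartAt 𝓘(ℝ, E) x x with hp
  set Ψ := chartMap E F ψ x with hΨdef
  have hΨ : ContDiffAt ℝ ∞ Ψ p := chartMap_contDiffAt hψ.smooth x
  have hΨp : Ψ p = extChartAt 𝓘(ℝ, F) (ψ x) (ψ x) := chartMap_self ψ x
  have hD : ContDiffAt ℝ ∞ (fderiv ℝ Ψ) p := hΨ.fderiv_right (m := ∞) (by simp)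
  have hv : ∀ i, ContDiffAt ℝ ∞ (fun e => chartV (Xi i) (ψ x) (Ψ e)) p := fun i =>
    ContDiffAt.comp (g := chartV (Xi i) (ψ x)) _
      (by rw [hΨp]; exact (hsec i).smooth_left.chartV (ψ x)) hΨ
  have hα : ∀ i, ContDiffAt ℝ ∞ (fun e => chartForm (αi i) (ψ x) (Ψ e)) p := fun i =>
    ContDiffAt.comp (g := chartForm (αi i) (ψ x)) _
      (by rw [hΨp]; exact (hsec i).smooth_right.chartForm (ψ x)) hΨ
  have hspan' : ∀ᶠ e in 𝓝 p, Submodule.span ℝ (Set.range fun i =>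
      ((Xi i (ψ ((extChartAt 𝓘(ℝ, E) x).symm e)), αi i (ψ ((extChartAt 𝓘(ℝ, E) x).symm e))) :
        GTan F (ψ ((extChartAt 𝓘(ℝ, E) x).symm e)))) =
        L (ψ ((extChartAt 𝓘(ℝ, E) x).symm e)) := by
    have hc : Tendsto (fun e => ψ ((extChartAt 𝓘(ℝ, E) x).symm e)) (𝓝 p) (𝓝 (ψ x)) := by
      have h1 := (hψ.smooth.continuous.tendsto ((extChartAt 𝓘(ℝ, E) x).symm p)).comp
        (continuousAt_extChartAt_symm (I := 𝓘(ℝ, E)) x)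
      rwa [hp, extChartAt_to_inv] at h1
    exact hc.eventually hspan
  have hrange : ∀ᶠ e in 𝓝 p, Submodule.span ℝ (Set.range fun i => chartV (Xi i) (ψ x) (Ψ e)) =
      LinearMap.range (fderiv ℝ Ψ e).toLinearMap := by
    filter_upwards [hspan', eventually_mem_target x, eventually_mem_source hψ.smooth x]
      with e hs he he'
    have hXi : ∀ i, chartV (Xi i) (ψ x) (Ψ e) = chartD (ψ x) _
        (Xi i (ψ ((extChartAt 𝓘(ℝ, E) x).symm e))) := fun i => chartV_extChartAt (Xi i) he'
    refine le_antisymm (Submodule.span_le.2 ?_) ?_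
    · rintro _ ⟨i, rfl⟩
      obtain ⟨w, hw⟩ := (h _ _).2 ⟨_, (hsec i).mem (ψ ((extChartAt 𝓘(ℝ, E) x).symm e))⟩
      refine ⟨chartD x _ w, ?_⟩
      refine (fderiv_chartMap hψ.smooth he he' _).trans ?_
      rw [chartDSymm_chartD he, hw]
      exact (hXi i).symm
    · rintro _ ⟨w, rfl⟩
      obtain ⟨β, hβ⟩ := (h ((extChartAt 𝓘(ℝ, E) x).symm e) _).1 ⟨chartDSymm x e w, rfl⟩
      rw [← hs] at hβ
      obtain ⟨c, hc⟩ := (Submodule.mem_span_range_iff_exists_fun ℝ).1 hβ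
      refine (Submodule.mem_span_range_iff_exists_fun ℝ).2 ⟨c, ?_⟩
      refine Eq.trans ?_ (fderiv_chartMap hψ.smooth he he' w).symm
      have hc1 := congrArg Prod.fst hc
      rw [Prod.fst_sum] at hc1
      refine Eq.trans ?_ (congrArg (chartD (ψ x) _) hc1)
      rw [map_sum]
      simp only [hXi, Prod.smul_fst, map_smul]
  obtain ⟨f, hf, hfe⟩ := exists_smooth_coeff hv
    (by
      filter_upwards [hrange] with e he
      rw [he, hrange.self_of_nhds, LinearMap.finrank_range_of_inj (fderiv_chartMap_injective hψ x)]
      exact LinearMap.finrank_range_le _)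
    (hD.clm_apply (contDiffAt_const (c := u)))
    (by
      filter_upwards [hrange] with e he
      rw [he]
      exact ⟨u, rfl⟩)
  have hsmooth : ContDiffAt ℝ ∞ (fun e => ∑ i, f i e •
      (chartForm (αi i) (ψ x) (Ψ e)).comp (fderiv ℝ Ψ e)) p :=
    ContDiffAt.sum fun i _ => (hf i).smul ((hα i).clm_comp hD)
  refine hsmooth.congr_of_eventuallyEq ?_
  filter_upwards [hfe, eventually_mem_target x, eventually_mem_source hψ.smooth x]
    with e hfe he he'
  have hXi : ∀ i, chartV (Xi i) (ψ x) (Ψ e) = chartD (ψ x) _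
      (Xi i (ψ ((extChartAt 𝓘(ℝ, E) x).symm e))) := fun i => chartV_extChartAt (Xi i) he'
  have h1 : tmap E F ψ ((extChartAt 𝓘(ℝ, E) x).symm e) (chartDSymm x e u) =
      ∑ i, f i e • Xi i (ψ ((extChartAt 𝓘(ℝ, E) x).symm e)) := by
    refine chartD_injective he' ?_
    refine (fderiv_chartMap hψ.smooth he he' u).symm.trans (hfe.trans ?_)
    rw [map_sum]
    simp only [hXi, map_smul]
  have h2 : ((tmap E F ψ ((extChartAt 𝓘(ℝ, E) x).symm e) (chartDSymm x e u),
      ∑ i, f i e • αi i (ψ ((extChartAt 𝓘(ℝ, E) x).symm e))) :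
      GTan F (ψ ((extChartAt 𝓘(ℝ, E) x).symm e))) ∈ L _ := by
    have h3 := Submodule.sum_mem (L (ψ ((extChartAt 𝓘(ℝ, E) x).symm e)))
      (t := Finset.univ) (f := fun i => f i e • ((Xi i (ψ ((extChartAt 𝓘(ℝ, E) x).symm e)),
        αi i (ψ ((extChartAt 𝓘(ℝ, E) x).symm e))) : GTan F _))
      fun i _ => Submodule.smul_mem _ _ ((hsec i).mem _)
    convert h3 using 1
    refine Prod.ext ?_ ?_
    · rw [Prod.fst_sum, h1]
      rfl
    · rw [Prod.snd_sum]
      rfl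
  have h3 := hΩ _ _ _ h2
  refine ContinuousLinearMap.ext fun v => ?_
  have h4 : chartBilin Ω x u e v = (∑ i, f i e • αi i (ψ ((extChartAt 𝓘(ℝ, E) x).symm e)))
      (tmap E F ψ ((extChartAt 𝓘(ℝ, E) x).symm e) (chartDSymm x e v)) :=
    congrArg (fun T => T (chartDSymm x e v)) h3
  rw [h4]
  simp only [sum_apply, smul_apply, ContinuousLinearMap.comp_apply]
  refine Finset.sum_congr rfl fun i _ => ?_
  exact congrArg (fun t : ℝ => f i e • t) (chartForm_chartMap hψ.smooth he he' (αi i) v).symm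

end Integral

end DiracGeom

end

theorem proposition4p1
    {E : Type*} [NormedAddCommGroup E] [NormedSpace ℝ E] [FiniteDimensional ℝ E]
    {F : Type*} [NormedAddCommGroup F] [NormedSpace ℝ F] [FiniteDimensional ℝ F]
    {N : Type*} [TopologicalSpace N] [T2Space N] [ChartedSpace E N] [IsManifold 𝓘(ℝ, E) ∞ N]
    {M : Type*} [TopologicalSpace M] [T2Space M] [ChartedSpace F M] [IsManifold 𝓘(ℝ, F) ∞ M]
    (ψ : N → M) (hψ : ContMDiff 𝓘(ℝ, E) 𝓘(ℝ, F) ∞ ψ)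
    (LM : DiracGeom.SubFamily F M) (hLM : DiracGeom.IsDirac LM)
    (rM : DiracGeom.Tensor11 F M) (hrM : DiracGeom.SmoothTensor11 rM)
    (hcomp : DiracGeom.IsCompatible LM rM) :
    -- backward Dirac maps
    (∀ (LN : DiracGeom.SubFamily E N) (rN : DiracGeom.Tensor11 E N),
      DiracGeom.IsDirac LN → DiracGeom.SmoothTensor11 rN →
      DiracGeom.IsBackwardDirac ψ LN LM → DiracGeom.AreRelated ψ rN rM →
      DiracGeom.IsCompatible LN rN) ∧
    -- invariant submanifolds
    (DiracGeom.IsSubmanifold E F ψ → DiracGeom.IsInvariant E ψ rM →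
      DiracGeom.IsSubbundle (DiracGeom.backward (E := E) ψ LM) →
      ∃ rN : DiracGeom.Tensor11 E N, DiracGeom.SmoothTensor11 rN ∧
        DiracGeom.AreRelated ψ rN rM ∧
        DiracGeom.IsDirac (DiracGeom.backward (E := E) ψ LM) ∧
        DiracGeom.IsCompatible (DiracGeom.backward ψ LM) rN ∧
        (DiracGeom.IsNijenhuis rM →
          DiracGeom.IsDiracNijenhuis (DiracGeom.backward ψ LM) rN)) ∧
    -- presymplectic leaves
    (DiracGeom.IsSubmanifold E F ψ → DiracGeom.IsIntegral E ψ LM →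
      DiracGeom.IsInvariant E ψ rM ∧
      ∃ (rN : DiracGeom.Tensor11 E N) (Ω : DiracGeom.BilinField E N),
        DiracGeom.SmoothTensor11 rN ∧ DiracGeom.AreRelated ψ rN rM ∧
        DiracGeom.IsTwoForm Ω ∧ DiracGeom.IsClosedTwoForm Ω ∧
        DiracGeom.backward ψ LM = DiracGeom.graph Ω ∧
        DiracGeom.IsFormCompatible Ω rN ∧
        (DiracGeom.IsNijenhuis rM → DiracGeom.IsPresymplecticNijenhuis Ω rN)) := by
  refine ⟨fun LN rN hLN hrN hback hrel => ?_, fun hψ' hinv hB => ?_, fun hψ' hint => ?_⟩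
  · obtain rfl : LN = DiracGeom.backward ψ LM := funext hback
    exact hcomp.backward hψ hLM.subbundle hLN.toIsLagrangian hrN hrM hrel
  · obtain ⟨rN, hrN, hrel⟩ := DiracGeom.exists_restrict hψ' hrM hinv
    have hD := hLM.backward hψ hB
    have hC := hcomp.backward hψ hLM.subbundle hD.toIsLagrangian hrN hrM hrel
    exact ⟨rN, hrN, hrel, hD, hC, fun hN => ⟨hD, hrN, hN.of_areRelated hψ' hrN hrM hrel, hC⟩⟩
  · have hinv := hint.isInvariant hcomp.map_mem
    obtain ⟨rN, hrN, hrel⟩ := DiracGeom.exists_restrict hψ' hrM hinv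
    obtain ⟨Ω, halt, hΩ⟩ := hint.exists_bilinField fun x p hp => (hLM.mem_iff x p).1 hp
    have hΩ2 := hint.isTwoForm hψ' hLM.subbundle halt hΩ
    have hgr := hint.backward_eq_graph hΩ
    have hB : DiracGeom.IsSubbundle (DiracGeom.backward (E := E) ψ LM) :=
      hgr ▸ hΩ2.isSubbundle_graph
    have hD := hLM.backward hψ hB
    have hC := hcomp.backward hψ hLM.subbundle hD.toIsLagrangian hrN hrM hrel
    rw [hgr] at hD hC
    have hcl := hΩ2.isClosedTwoForm hD.involutive
    have hF := hC.isFormCompatible hΩ2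
    exact ⟨hinv, rN, Ω, hrN, hrel, hΩ2, hcl, hgr, hF, fun hN =>
      ⟨hΩ2, hcl, hrN, hN.of_areRelated hψ' hrN hrM hrel, hF⟩⟩
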